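/- All vector spaces are over $\mathbb{C}$. Let $\mathfrak{g}=\mathfrak{n}_-\oplus\mathfrak{h}\oplus\mathfrak{n}_+$ be a Lie algebra with a triangular decomposition in the sense of Moody and Pianzola: $\mathfrak{n}_\pm$ and $\mathfrak{h}$ are subalgebras, $\mathfrak{h}$ is abelian, $\mathfrak{n}_+$ is the sum of its weight spaces for the adjoint action of $\mathfrak{h}$, with nonzero weights in a free additive monoid $Q_+\subset\mathfrak{h}^*$ having a linearly independent basis, and there is an anti-involution $\sigma$ of $\mathfrak{g}$ with $\sigma|_{\mathfrak{h}}=\mathrm{id}$ and $\sigma(\mathfrak{n}_+)=\mathfrak{n}_-$. Let $\mu\in\mathfrak{h}^*$ and let $\lambda:\mathfrak{n}_+\to\mathbb{C}$ be any Lie algebra homomorphism. Let $M_\lambda=U(\mathfrak{g})\otimes_{U(\mathfrak{n}_+)}\mathbb{C}v_\lambda$ be the standard Whittaker module, where $xv_\lambda=\lambda(x)v_\lambda$ for $x\in\mathfrak{n}_+$. Let $N(-\mu)=U(\mathfrak{g})\otimes_{U(\mathfrak{h}\oplus\mathfrak{n}_-)}\mathbb{C}_{-\mu}$ be the lowest weight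 Verma module with lowest weight $-\mu$ ($\mathfrak{n}_-$ acts on $\mathbb{C}_{-\mu}$ by $0$ and $\mathfrak{h}$ by $-\mu$), and let $N(-\mu)^*$ be its full dual with the action $(xf)(u)=-f(xu)$. For a $\mathfrak{g}$-module $V$ put $W_\lambda(V)=\{w\in V: xw=\lambda(x)w\text{ for all }x\in\mathfrak{n}_+\}$. Then $\dim W_\lambda(N(-\mu)^*)=1$, and for each $w\in W_\lambda(N(-\mu)^*)$ there is a unique $\mathfrak{g}$-homomorphism $M_\lambda\to N(-\mu)^*$ with $v_\lambda\mapsto w$. So there is a nonzero homomorphism $M_\lambda\to N(-\mu)^*$, unique up to a scalar; let $L(\lambda,\mu)$ be its image. The $\mathfrak{g}$-module $L(\lambda,\mu)$ is simple, $\dim W_\lambda(L(\lambda,\mu))=1$, and $W_\lambda(L(\lambda,\mu))$ is the set of all Whittaker vectors of $L(\lambda,\mu)$, that is, of all $w$ for which the line $\langle w\rangle$ is $\mathfrak{n}_+$-stable. In particular, let $\mathfrak{g}$ be the Virasoro algebra, with basis $e_i$ ($i\in\mathbb{Z}$) and $z$, where $z$ is central and $[e_i,e_j]=(j-i)e_{i+j}+\delta_{i+j,0}\frac{j^3-j}{12}z$,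 and with $\mathfrak{n}_\pm=\langle e_{\pm i}: i>0\rangle$ and $\mathfrak{h}=\langle e_0,z\rangle$. Then for all $a,b\in\mathbb{C}$ there is exactly one character $\lambda$ of $\mathfrak{n}_+$ with $\lambda(e_1)=a$ and $\lambda(e_2)=b$; and for every $\mu\in\mathfrak{h}^*$ and every character $\lambda$ of $\mathfrak{n}_+$, with no restriction on $\lambda$, the module $L(\lambda,\mu)$ is a simple Whittaker module (a simple module on which $\mathfrak{n}_+$ acts locally finitely) with $\dim W_\lambda(L(\lambda,\mu))=1$. -/

import Mathlib

noncomputable section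

namespace WhittakerPairs

open LieAlgebra Module

universe u v

attribute [local instance 100] LieRing.ofAssociativeRing

/-! ## Lie algebras with triangular decomposition -/

/-- The space of vectors of weight `α` with respect to the adjoint action of a subalgebra `h`. -/
def adWeightSpace {g : Type u} [LieRing g] [LieAlgebra ℂ g] (h : LieSubalgebra ℂ g)
    (α : Dual ℂ h) : Submodule ℂ g where
  carrier := {x | ∀ t : h, ⁅(t : g), x⁆ = α t • x}
  add_mem' := by
    intro a b ha hb t
    rw [lie_add, ha t, hb t, smul_add]
  zero_mem' := by
    intro t
    simp
  smul_mem' := by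
    intro c x hx t
    rw [lie_smul, hx t, smul_comm]

/-- A triangular decomposition `g = n₋ ⊕ h ⊕ n₊` in the sense of Moody and Pianzola: `h` is an
abelian subalgebra, `n₊` is a sum of weight spaces for `h` with nonzero weights in a free additive
monoid `Q₊` with a linearly independent basis `Π ⊆ h*`, and there is an anti-involution `σ` of `g`
which is the identity on `h` and maps `n₊` onto `n₋`.
There is no condition on the dimensions of the root spaces or on the cardinality of `Π`. -/
structure TriangularDecomposition (g : Type u) [LieRing g] [LieAlgebra ℂ g] where
  /-- the subalgebra `h` -/
  cartan : LieSubalgebra ℂ g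
  /-- the subalgebra `n₊` -/
  nPos : LieSubalgebra ℂ g
  /-- the subalgebra `n₋` -/
  nNeg : LieSubalgebra ℂ g
  /-- the basis `Π` of `Q₊` -/
  simpleRoots : Set (Dual ℂ cartan)
  /-- the anti-involution -/
  sigma : g →ₗ[ℂ] g
  cartan_abelian : ∀ x ∈ cartan, ∀ y ∈ cartan, ⁅x, y⁆ = 0
  linearIndependent : LinearIndepOn ℂ id simpleRoots
  weight_decomposition : nPos.toSubmodule =
    ⨆ α ∈ {α : Dual ℂ cartan | α ∈ AddSubmonoid.closure simpleRoots ∧ α ≠ 0},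
      nPos.toSubmodule ⊓ adWeightSpace cartan α
  sigma_sigma : ∀ x, sigma (sigma x) = x
  sigma_lie : ∀ x y, sigma ⁅x, y⁆ = ⁅sigma y, sigma x⁆
  sigma_cartan : ∀ x ∈ cartan, sigma x = x
  sigma_nPos : nPos.toSubmodule.map sigma = nNeg.toSubmodule
  isInternal : DirectSum.IsInternal
    ![nNeg.toSubmodule, cartan.toSubmodule, nPos.toSubmodule]

namespace TriangularDecomposition

variable {g : Type u} [LieRing g] [LieAlgebra ℂ g] (D : TriangularDecomposition g)

lemma isCompl_cartan :
    IsCompl D.cartan.toSubmodule (D.nNeg.toSubmodule ⊔ D.nPos.toSubmodule) := by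
  obtain ⟨hind, htop⟩ := (DirectSum.isInternal_submodule_iff_iSupIndep_and_iSup_eq_top _).1
    D.isInternal
  have h1 := hind 1
  have e : (⨆ j, ⨆ (_ : j ≠ (1 : Fin 3)),
      ![D.nNeg.toSubmodule, D.cartan.toSubmodule, D.nPos.toSubmodule] j) =
      D.nNeg.toSubmodule ⊔ D.nPos.toSubmodule := by
    apply le_antisymm
    · refine iSup_le fun j => iSup_le fun hj => ?_
      fin_cases j
      · exact le_sup_left
      · exact absurd rfl hj
      · exact le_sup_right
    · refine sup_le ?_ ?_
      · exact le_iSup₂_of_le (0 : Fin 3) (by decide) le_rfl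
      · exact le_iSup₂_of_le (2 : Fin 3) (by decide) le_rfl
  rw [e] at h1
  refine ⟨h1, ?_⟩
  rw [codisjoint_iff, eq_top_iff, ← htop]
  refine iSup_le fun j => ?_
  fin_cases j
  · exact le_sup_of_le_right le_sup_left
  · exact le_sup_left
  · exact le_sup_of_le_right le_sup_right

/-- The linear projection of `g` onto `h` with kernel `n₋ ⊕ n₊`. -/
def projCartan : g →ₗ[ℂ] D.cartan :=
  Submodule.projectionOnto _ _ D.isCompl_cartan

lemma projCartan_cartan (t : D.cartan) : D.projCartan t = t :=
  Submodule.projectionOnto_apply_left D.isCompl_cartan t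

lemma projCartan_nNeg {x : g} (hx : x ∈ D.nNeg) : D.projCartan x = 0 :=
  Submodule.projectionOnto_apply_of_mem_right D.isCompl_cartan
    ((le_sup_left : D.nNeg.toSubmodule ≤ _) hx)

lemma lie_cartan_nPos {t x : g} (ht : t ∈ D.cartan) (hx : x ∈ D.nPos) : ⁅t, x⁆ ∈ D.nPos := by
  have key : D.nPos.toSubmodule ≤
      D.nPos.toSubmodule.comap (LieAlgebra.ad ℂ g t : g →ₗ[ℂ] g) := by
    conv_lhs => rw [D.weight_decomposition]
    refine iSup_le fun α => iSup_le fun _ => ?_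
    rintro y ⟨hy, hyα⟩
    have : ⁅t, y⁆ = α ⟨t, ht⟩ • y := hyα ⟨t, ht⟩
    simp only [Submodule.mem_comap, LieAlgebra.ad_apply, this]
    exact Submodule.smul_mem _ _ hy
  exact key hx

lemma lie_cartan_nNeg {t y : g} (ht : t ∈ D.cartan) (hy : y ∈ D.nNeg) : ⁅t, y⁆ ∈ D.nNeg := by
  have hy' : y ∈ D.nPos.toSubmodule.map D.sigma := by
    rw [D.sigma_nPos]
    exact hy
  obtain ⟨x, hx, rfl⟩ := hy'
  have h1 : ⁅t, D.sigma x⁆ = D.sigma ⁅x, t⁆ := by rw [D.sigma_lie, D.sigma_cartan t ht]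
  have h2 : ⁅x, t⁆ ∈ D.nPos := by
    rw [← lie_skew]
    exact neg_mem (D.lie_cartan_nPos ht hx)
  have h3 : D.sigma ⁅x, t⁆ ∈ D.nPos.toSubmodule.map D.sigma := ⟨_, h2, rfl⟩
  rw [D.sigma_nPos] at h3
  rw [h1]
  exact h3

lemma lie_mem_nNeg {x y : g} (hx : x ∈ D.cartan.toSubmodule ⊔ D.nNeg.toSubmodule)
    (hy : y ∈ D.cartan.toSubmodule ⊔ D.nNeg.toSubmodule) : ⁅x, y⁆ ∈ D.nNeg := by
  obtain ⟨s, hs, a, ha, rfl⟩ := Submodule.mem_sup.1 hx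
  obtain ⟨t, ht, b, hb, rfl⟩ := Submodule.mem_sup.1 hy
  rw [lie_add, add_lie, add_lie, D.cartan_abelian s hs t ht, zero_add]
  refine add_mem ?_ (add_mem (D.lie_cartan_nNeg hs hb) (D.nNeg.lie_mem ha hb))
  rw [← lie_skew]
  exact neg_mem (D.lie_cartan_nNeg ht ha)

/-- The subalgebra `h ⊕ n₋`. -/
def borelNeg : LieSubalgebra ℂ g where
  __ := D.cartan.toSubmodule ⊔ D.nNeg.toSubmodule
  lie_mem' := fun hx hy =>
    (le_sup_right : D.nNeg.toSubmodule ≤ D.cartan.toSubmodule ⊔ _) (D.lie_mem_nNeg hx hy)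

/-- The character `h + n ↦ μ h` of `h ⊕ n₋`. -/
def borelNegCharacter (μ : Dual ℂ D.cartan) : LieCharacter ℂ D.borelNeg where
  toLinearMap := μ ∘ₗ D.projCartan ∘ₗ D.borelNeg.toSubmodule.subtype
  map_lie' := by
    intro x y
    change μ (D.projCartan ⁅(x : g), (y : g)⁆) = μ _ * μ _ - μ _ * μ _
    rw [D.projCartan_nNeg (D.lie_mem_nNeg x.2 y.2), map_zero, mul_comm, sub_self]

end TriangularDecomposition

/-! ## Modules induced from one-dimensional modules -/

section Induced

variable {g : Type u} [LieRing g] [LieAlgebra ℂ g]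

/-- The left ideal `∑ U(g) (x - χ(x))`, `x ∈ p`, of the universal enveloping algebra of `g`. -/
def inducedIdeal (p : LieSubalgebra ℂ g) (χ : LieCharacter ℂ p) :
    Submodule (UniversalEnvelopingAlgebra ℂ g) (UniversalEnvelopingAlgebra ℂ g) :=
  Submodule.span _ (Set.range fun x : p =>
    UniversalEnvelopingAlgebra.ι ℂ (x : g) -
      algebraMap ℂ (UniversalEnvelopingAlgebra ℂ g) (χ x))

/-- The induced module `U(g) ⊗_{U(p)} ℂ_χ`, where `ℂ_χ` is the one-dimensional `p`-module with
character `χ`, as the quotient of `U(g)` by the left ideal generated by all `x - χ(x)`. -/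
def Induced (p : LieSubalgebra ℂ g) (χ : LieCharacter ℂ p) : Type u :=
  UniversalEnvelopingAlgebra ℂ g ⧸ inducedIdeal p χ

variable (p : LieSubalgebra ℂ g) (χ : LieCharacter ℂ p)

instance : AddCommGroup (Induced p χ) :=
  inferInstanceAs (AddCommGroup (UniversalEnvelopingAlgebra ℂ g ⧸ inducedIdeal p χ))

instance : Module (UniversalEnvelopingAlgebra ℂ g) (Induced p χ) :=
  inferInstanceAs (Module (UniversalEnvelopingAlgebra ℂ g)
    (UniversalEnvelopingAlgebra ℂ g ⧸ inducedIdeal p χ))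

instance : Module ℂ (Induced p χ) :=
  inferInstanceAs (Module ℂ (UniversalEnvelopingAlgebra ℂ g ⧸ inducedIdeal p χ))

instance : IsScalarTower ℂ (UniversalEnvelopingAlgebra ℂ g) (Induced p χ) :=
  inferInstanceAs (IsScalarTower ℂ (UniversalEnvelopingAlgebra ℂ g)
    (UniversalEnvelopingAlgebra ℂ g ⧸ inducedIdeal p χ))

/-- The Lie algebra `g` acts on the induced module through `g → U(g)`. -/
instance : LieRingModule g (Induced p χ) where
  bracket x m := UniversalEnvelopingAlgebra.ι ℂ x • m
  add_lie x y m := by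
    rw [map_add, add_smul]
  lie_add x m n := smul_add _ m n
  leibniz_lie x y m := by
    change UniversalEnvelopingAlgebra.ι ℂ x • UniversalEnvelopingAlgebra.ι ℂ y • m =
      UniversalEnvelopingAlgebra.ι ℂ ⁅x, y⁆ • m +
        UniversalEnvelopingAlgebra.ι ℂ y • UniversalEnvelopingAlgebra.ι ℂ x • m
    rw [LieHom.map_lie, LieRing.of_associative_ring_bracket, sub_smul, mul_smul, mul_smul,
      sub_add_cancel]

lemma Induced.lie_def (x : g) (m : Induced p χ) :
    ⁅x, m⁆ = UniversalEnvelopingAlgebra.ι ℂ x • m := rfl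

instance : LieModule ℂ g (Induced p χ) where
  smul_lie c x m := by
    rw [Induced.lie_def, Induced.lie_def, map_smul, smul_assoc]
  lie_smul c x m := by
    rw [Induced.lie_def, Induced.lie_def,
      ← algebraMap_smul (UniversalEnvelopingAlgebra ℂ g) c m,
      ← algebraMap_smul (UniversalEnvelopingAlgebra ℂ g) c
        (UniversalEnvelopingAlgebra.ι ℂ x • m), smul_smul, smul_smul, Algebra.commutes]

/-- The canonical generator `1 ⊗ v_χ` of the induced module. -/
def Induced.generator : Induced p χ :=
  Submodule.mkQ (inducedIdeal p χ) 1

end Induced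

/-! ## Whittaker vectors and Whittaker modules -/

namespace TriangularDecomposition

variable {g : Type u} [LieRing g] [LieAlgebra ℂ g] (D : TriangularDecomposition g)

/-- The standard Whittaker module `M_lam = U(g) ⊗_{U(n₊)} L_lam`. -/
abbrev StandardWhittaker (lam : LieCharacter ℂ D.nPos) : Type u :=
  Induced D.nPos lam

/-- The lowest weight Verma module `N(μ)` with lowest weight `μ`. -/
abbrev LowestVerma (μ : Dual ℂ D.cartan) : Type u :=
  Induced D.borelNeg (D.borelNegCharacter μ)

variable (V : Type v) [AddCommGroup V] [Module ℂ V] [LieRingModule g V] [LieModule ℂ g V]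

/-- The space `W_lam(V)` of vectors on which `n₊` acts through the character `lam`. -/
def whittakerSpace (lam : LieCharacter ℂ D.nPos) : Submodule ℂ V where
  carrier := {w | ∀ x : D.nPos, ⁅(x : g), w⁆ = lam x • w}
  add_mem' := by
    intro a b ha hb x
    rw [lie_add, ha x, hb x, smul_add]
  zero_mem' := by
    intro x
    simp
  smul_mem' := by
    intro c w hw x
    rw [lie_smul, hw x, smul_comm]

/-- The set of all Whittaker vectors: those `w` for which the line `⟨w⟩` is `n₊`-stable. -/
def whittakerVectors : Set V :=
  {w | ∀ x : D.nPos, ⁅(x : g), w⁆ ∈ Submodule.span ℂ {w}}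

/-- `V` is a Whittaker module for `(g, n₊)`: the action of `n₊` is locally finite, that is, the
`n₊`-submodule `U(n₊) w` generated by each vector `w` is finite-dimensional. -/
def IsWhittakerModule : Prop :=
  ∀ w : V, FiniteDimensional ℂ (LieSubmodule.lieSpan ℂ D.nPos ({w} : Set V))

end TriangularDecomposition

/-! ## The Virasoro algebra -/

/-- The Virasoro algebra has the basis `e i`, `i ∈ ℤ`, together with a central element `z`: an
element consists of the finitely many coefficients at the `e i` and the coefficient at `z`. -/
@[ext]
structure Virasoro where
  /-- the coefficients at the `e i` -/
  coeff : ℤ →₀ ℂ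
  /-- the coefficient at `z` -/
  central : ℂ

namespace Virasoro

/-- The bilinear form `β` with `[e i, e j] = (j - i) e (i + j)`, extended bilinearly. -/
def wittBracket : (ℤ →₀ ℂ) →ₗ[ℂ] (ℤ →₀ ℂ) →ₗ[ℂ] (ℤ →₀ ℂ) :=
  Finsupp.lift _ ℂ ℤ fun i => Finsupp.lift _ ℂ ℤ fun j =>
    Finsupp.single (i + j) ((j : ℂ) - i)

/-- The cocycle with `(e i, e j) ↦ δ_{i+j,0} (j³ - j) / 12`, extended bilinearly. -/
def cocycle : (ℤ →₀ ℂ) →ₗ[ℂ] (ℤ →₀ ℂ) →ₗ[ℂ] ℂ :=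
  Finsupp.lift _ ℂ ℤ fun i => Finsupp.lift _ ℂ ℤ fun j =>
    if i + j = 0 then ((j : ℂ) ^ 3 - j) / 12 else 0

lemma wittBracket_single (i j : ℤ) (a b : ℂ) :
    wittBracket (Finsupp.single i a) (Finsupp.single j b) =
      Finsupp.single (i + j) (a * b * ((j : ℂ) - i)) := by
  simp [wittBracket, mul_assoc, -Finsupp.single_sub, -Finsupp.single_mul]

lemma cocycle_single (i j : ℤ) (a b : ℂ) :
    cocycle (Finsupp.single i a) (Finsupp.single j b) =
      if i + j = 0 then a * b * (((j : ℂ) ^ 3 - j) / 12) else 0 := by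
  simp [cocycle, mul_assoc]

/-- As a vector space the Virasoro algebra is `ℂ^{(ℤ)} ⊕ ℂ`. -/
def equivProd : Virasoro ≃ (ℤ →₀ ℂ) × ℂ where
  toFun x := (x.coeff, x.central)
  invFun p := ⟨p.1, p.2⟩

instance : AddCommGroup Virasoro := equivProd.addCommGroup

instance : Module ℂ Virasoro := equivProd.module ℂ

@[simp] lemma coeff_add (x y : Virasoro) : (x + y).coeff = x.coeff + y.coeff := rfl
@[simp] lemma central_add (x y : Virasoro) : (x + y).central = x.central + y.central := rfl
@[simp] lemma coeff_zero : (0 : Virasoro).coeff = 0 := rfl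
@[simp] lemma central_zero : (0 : Virasoro).central = 0 := rfl
@[simp] lemma coeff_smul (c : ℂ) (x : Virasoro) : (c • x).coeff = c • x.coeff := rfl
@[simp] lemma central_smul (c : ℂ) (x : Virasoro) : (c • x).central = c * x.central := rfl

/-- The bracket is `[e i, e j] = (j - i) e (i + j) + δ_{i+j,0} (j³ - j) / 12 z`, and `z` is
central. -/
instance : Bracket Virasoro Virasoro where
  bracket x y := ⟨wittBracket x.coeff y.coeff, cocycle x.coeff y.coeff⟩

@[simp] lemma coeff_lie (x y : Virasoro) : ⁅x, y⁆.coeff = wittBracket x.coeff y.coeff := rfl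
@[simp] lemma central_lie (x y : Virasoro) : ⁅x, y⁆.central = cocycle x.coeff y.coeff := rfl

lemma wittBracket_skew (x y : ℤ →₀ ℂ) : wittBracket x y = -wittBracket y x := by
  induction x using Finsupp.induction_linear with
  | zero => simp
  | add f g hf hg => simp only [map_add, LinearMap.add_apply, hf, hg, neg_add]
  | single i a =>
    induction y using Finsupp.induction_linear with
    | zero => simp
    | add f g hf hg => simp only [map_add, LinearMap.add_apply, hf, hg, neg_add]
    | single j b =>
      rw [wittBracket_single, wittBracket_single, ← Finsupp.single_neg, add_comm j i]
      congr 1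
      ring

lemma cocycle_skew (x y : ℤ →₀ ℂ) : cocycle x y = -cocycle y x := by
  induction x using Finsupp.induction_linear with
  | zero => simp
  | add f g hf hg => simp only [map_add, LinearMap.add_apply, hf, hg, neg_add]
  | single i a =>
    induction y using Finsupp.induction_linear with
    | zero => simp
    | add f g hf hg => simp only [map_add, LinearMap.add_apply, hf, hg, neg_add]
    | single j b =>
      rw [cocycle_single, cocycle_single, add_comm j i]
      split_ifs with h
      · obtain rfl : i = -j := by omega
        push_cast
        ring
      · simp

lemma wittBracket_jacobi (x y z : ℤ →₀ ℂ) :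
    wittBracket x (wittBracket y z) =
      wittBracket (wittBracket x y) z + wittBracket y (wittBracket x z) := by
  induction x using Finsupp.induction_linear with
  | zero => simp
  | add f g hf hg =>
    simp only [map_add, LinearMap.add_apply, hf, hg]
    abel
  | single i a =>
    induction y using Finsupp.induction_linear with
    | zero => simp
    | add f g hf hg =>
      simp only [map_add, LinearMap.add_apply, hf, hg]
      abel
    | single j b =>
      induction z using Finsupp.induction_linear with
      | zero => simp
      | add f g hf hg =>
        simp only [map_add, hf, hg]
        abel
      | single k c =>
        simp only [wittBracket_single]
        rw [add_assoc i j k, add_left_comm j i k, ← Finsupp.single_add]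
        congr 1
        push_cast
        ring

lemma cocycle_jacobi (x y z : ℤ →₀ ℂ) :
    cocycle x (wittBracket y z) = cocycle (wittBracket x y) z + cocycle y (wittBracket x z) := by
  induction x using Finsupp.induction_linear with
  | zero => simp
  | add f g hf hg =>
    simp only [map_add, LinearMap.add_apply, hf, hg]
    abel
  | single i a =>
    induction y using Finsupp.induction_linear with
    | zero => simp
    | add f g hf hg =>
      simp only [map_add, LinearMap.add_apply, hf, hg]
      abel
    | single j b =>
      induction z using Finsupp.induction_linear with
      | zero => simp
      | add f g hf hg =>
        simp only [map_add, hf, hg]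
        abel
      | single k c =>
        simp only [wittBracket_single, cocycle_single]
        rw [add_assoc i j k, add_left_comm j i k]
        split_ifs with h
        · obtain rfl : i = -j - k := by omega
          push_cast
          ring
        · simp

instance : LieRing Virasoro where
  add_lie x y z := by ext1 <;> simp
  lie_add x y z := by ext1 <;> simp
  lie_self x := by
    ext1
    · exact self_eq_neg.1 (wittBracket_skew x.coeff x.coeff)
    · exact self_eq_neg.1 (cocycle_skew x.coeff x.coeff)
  leibniz_lie x y z := by
    ext1
    · exact wittBracket_jacobi _ _ _
    · exact cocycle_jacobi _ _ _

instance : LieAlgebra ℂ Virasoro where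
  lie_smul c x y := by ext1 <;> simp

/-- The basis element `e i`. -/
def e (i : ℤ) : Virasoro := ⟨Finsupp.single i 1, 0⟩

/-- The central basis element. -/
def z : Virasoro := ⟨0, 1⟩

lemma e_lie_e (i j : ℤ) : ⁅e i, e j⁆ =
    ((j : ℂ) - i) • e (i + j) + (if i + j = 0 then ((j : ℂ) ^ 3 - j) / 12 else 0) • z := by
  split_ifs with h <;> ext1 <;> simp [e, z, wittBracket_single, cocycle_single, h]

lemma z_lie (x : Virasoro) : ⁅z, x⁆ = 0 := by
  ext1 <;> simp [z]

lemma wittBracket_mem {s t u : Set ℤ} (h : ∀ i ∈ s, ∀ j ∈ t, i + j ∈ u) {x y : ℤ →₀ ℂ}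
    (hx : x ∈ Finsupp.supported ℂ ℂ s) (hy : y ∈ Finsupp.supported ℂ ℂ t) :
    wittBracket x y ∈ Finsupp.supported ℂ ℂ u := by
  rw [Finsupp.supported_eq_span_single] at hx hy
  induction hx using Submodule.span_induction with
  | zero => simp
  | add a b _ _ ha hb =>
    rw [map_add]
    exact add_mem ha hb
  | smul c a _ ha =>
    rw [map_smul]
    exact Submodule.smul_mem _ c ha
  | mem a ha =>
    obtain ⟨i, hi, rfl⟩ := ha
    induction hy using Submodule.span_induction with
    | zero => simp
    | add a b _ _ ha hb =>
      rw [map_add]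
      exact add_mem ha hb
    | smul c a _ ha =>
      rw [map_smul]
      exact Submodule.smul_mem _ c ha
    | mem b hb =>
      obtain ⟨j, hj, rfl⟩ := hb
      change wittBracket (Finsupp.single i 1) (Finsupp.single j 1) ∈ _
      rw [wittBracket_single]
      exact Finsupp.single_mem_supported ℂ _ (h i hi j hj)

lemma cocycle_eq_zero {s t : Set ℤ} (h : ∀ i ∈ s, ∀ j ∈ t, i + j = 0 → (j : ℂ) ^ 3 - j = 0)
    {x y : ℤ →₀ ℂ}
    (hx : x ∈ Finsupp.supported ℂ ℂ s) (hy : y ∈ Finsupp.supported ℂ ℂ t) :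
    cocycle x y = 0 := by
  rw [Finsupp.supported_eq_span_single] at hx hy
  induction hx using Submodule.span_induction with
  | zero => simp
  | add a b _ _ ha hb => simp [ha, hb]
  | smul c a _ ha => simp [ha]
  | mem a ha =>
    obtain ⟨i, hi, rfl⟩ := ha
    induction hy using Submodule.span_induction with
    | zero => simp
    | add a b _ _ ha hb => simp only [map_add, ha, hb, add_zero]
    | smul c a _ ha => simp only [map_smul, ha, smul_zero]
    | mem b hb =>
      obtain ⟨j, hj, rfl⟩ := hb
      change cocycle (Finsupp.single i 1) (Finsupp.single j 1) = _
      rw [cocycle_single]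
      split_ifs with hij
      · rw [h i hi j hj hij]
        simp
      · rfl

/-- The coefficients at the `e i`, as a linear map. -/
def coeffₗ : Virasoro →ₗ[ℂ] (ℤ →₀ ℂ) where
  toFun := coeff
  map_add' := coeff_add
  map_smul' := coeff_smul

/-- The coefficient at `z`, as a linear map. -/
def centralₗ : Virasoro →ₗ[ℂ] ℂ where
  toFun := central
  map_add' := central_add
  map_smul' := central_smul

/-- The subalgebra `h` spanned by `e 0` and `z`. -/
def cartan : LieSubalgebra ℂ Virasoro where
  __ := (Finsupp.supported ℂ ℂ ({0} : Set ℤ)).comap coeffₗ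
  lie_mem' := fun hx hy =>
    wittBracket_mem (by rintro i rfl j rfl; simp) hx hy

/-- The subalgebra `n₊` spanned by the `e i` with `i > 0`. -/
def nPos : LieSubalgebra ℂ Virasoro where
  __ := (Finsupp.supported ℂ ℂ {i : ℤ | 0 < i}).comap coeffₗ ⊓ LinearMap.ker centralₗ
  lie_mem' := fun hx hy =>
    ⟨wittBracket_mem (fun i hi j hj => by simp only [Set.mem_ofPred_eq] at *; omega) hx.1 hy.1,
      cocycle_eq_zero (fun i hi j hj h => by simp only [Set.mem_ofPred_eq] at *; omega)
        hx.1 hy.1⟩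

/-- The subalgebra `n₋` spanned by the `e i` with `i < 0`. -/
def nNeg : LieSubalgebra ℂ Virasoro where
  __ := (Finsupp.supported ℂ ℂ {i : ℤ | i < 0}).comap coeffₗ ⊓ LinearMap.ker centralₗ
  lie_mem' := fun hx hy =>
    ⟨wittBracket_mem (fun i hi j hj => by simp only [Set.mem_ofPred_eq] at *; omega) hx.1 hy.1,
      cocycle_eq_zero (fun i hi j hj h => by simp only [Set.mem_ofPred_eq] at *; omega)
        hx.1 hy.1⟩

/-- The anti-involution `e i ↦ e (-i)`, `z ↦ z`. -/
def sigma : Virasoro →ₗ[ℂ] Virasoro where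
  toFun x := ⟨Finsupp.lmapDomain ℂ ℂ (fun i : ℤ => -i) x.coeff, x.central⟩
  map_add' x y := by ext1 <;> simp only [coeff_add, central_add, map_add]
  map_smul' c x := by ext1 <;> simp

/-- The linear form on `h` with `e 0 ↦ 1` and `z ↦ 0`. -/
def simpleRoot : Dual ℂ cartan :=
  Finsupp.lapply 0 ∘ₗ coeffₗ ∘ₗ cartan.toSubmodule.subtype

lemma e_zero_mem_cartan : e 0 ∈ cartan :=
  Finsupp.single_mem_supported ℂ _ rfl

lemma simpleRoot_e_zero : simpleRoot ⟨e 0, e_zero_mem_cartan⟩ = 1 :=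
  Finsupp.single_eq_same

lemma e_mem_nPos {i : ℤ} (hi : 0 < i) : e i ∈ nPos :=
  ⟨Finsupp.single_mem_supported ℂ _ hi, rfl⟩

lemma cartan_eq {t : Virasoro} (ht : t ∈ cartan) :
    t.coeff = Finsupp.single 0 (t.coeff 0) := by
  ext i
  by_cases hi : i = 0
  · simp [hi]
  · rw [Finsupp.single_apply, if_neg (Ne.symm hi)]
    exact (Finsupp.mem_supported' ℂ _).1 ht i hi

lemma e_mem_adWeightSpace (n : ℕ) : e n ∈ adWeightSpace cartan (n • simpleRoot) := by
  intro t
  ext1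
  · rw [coeff_lie, cartan_eq t.2]
    have h : (n • simpleRoot) t = n * (t : Virasoro).coeff 0 := by
      rw [LinearMap.smul_apply, nsmul_eq_mul]
      rfl
    rw [h, e, wittBracket_single, coeff_smul, Finsupp.smul_single, zero_add, smul_eq_mul]
    congr 1
    push_cast
    ring
  · rw [central_lie, cartan_eq t.2]
    simp only [e, cocycle_single, zero_add, central_smul, mul_zero]
    split_ifs with h
    · simp [h]
    · rfl

lemma sigma_sigma (x : Virasoro) : sigma (sigma x) = x := by
  ext1
  · change Finsupp.mapDomain _ (Finsupp.mapDomain _ x.coeff) = x.coeff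
    rw [← Finsupp.mapDomain_comp]
    convert Finsupp.mapDomain_id
    simp
  · rfl

lemma mem_nNeg_iff (x : Virasoro) : x ∈ nNeg ↔ (∀ i, 0 ≤ i → x.coeff i = 0) ∧ x.central = 0 := by
  change x.coeff ∈ Finsupp.supported ℂ ℂ {i : ℤ | i < 0} ∧ x.central = 0 ↔ _
  rw [Finsupp.mem_supported']
  simp

lemma mem_nPos_iff (x : Virasoro) : x ∈ nPos ↔ (∀ i, i ≤ 0 → x.coeff i = 0) ∧ x.central = 0 := by
  change x.coeff ∈ Finsupp.supported ℂ ℂ {i : ℤ | 0 < i} ∧ x.central = 0 ↔ _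
  rw [Finsupp.mem_supported']
  simp

lemma mem_cartan_iff (x : Virasoro) : x ∈ cartan ↔ ∀ i, i ≠ 0 → x.coeff i = 0 := by
  change x.coeff ∈ Finsupp.supported ℂ ℂ {0} ↔ _
  rw [Finsupp.mem_supported']
  simp

lemma sigma_coeff (x : Virasoro) (i : ℤ) : (sigma x).coeff i = x.coeff (-i) := by
  change Finsupp.mapDomain (fun i : ℤ => -i) x.coeff i = _
  conv_lhs => rw [← neg_neg i]
  exact Finsupp.mapDomain_apply neg_injective _ _

lemma sigma_lie (x y : Virasoro) : sigma ⁅x, y⁆ = ⁅sigma y, sigma x⁆ := by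
  have h : ∀ x y : ℤ →₀ ℂ, Finsupp.lmapDomain ℂ ℂ (fun i : ℤ => -i) (wittBracket x y) =
      wittBracket (Finsupp.lmapDomain ℂ ℂ (fun i : ℤ => -i) y)
        (Finsupp.lmapDomain ℂ ℂ (fun i : ℤ => -i) x) ∧
      cocycle x y = cocycle (Finsupp.lmapDomain ℂ ℂ (fun i : ℤ => -i) y)
        (Finsupp.lmapDomain ℂ ℂ (fun i : ℤ => -i) x) := by
    intro x y
    induction x using Finsupp.induction_linear with
    | zero => simp
    | add f g hf hg =>
      simp only [map_add, LinearMap.add_apply, hf.1, hg.1, hf.2, hg.2, and_self]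
    | single i a =>
      induction y using Finsupp.induction_linear with
      | zero => simp
      | add f g hf hg =>
        simp only [map_add, LinearMap.add_apply, hf.1, hg.1, hf.2, hg.2, and_self]
      | single j b =>
        simp only [Finsupp.lmapDomain_apply, Finsupp.mapDomain_single, wittBracket_single,
          cocycle_single]
        constructor
        · rw [neg_add, add_comm (-i)]
          congr 1
          push_cast
          ring
        · have e1 : -j + -i = 0 ↔ i + j = 0 := by omega
          simp only [e1]
          split_ifs with hij
          · obtain rfl : i = -j := by omega
            push_cast
            ring
          · rfl
  ext1
  · exact (h _ _).1
  · exact (h _ _).2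

lemma iSupIndep_three {M : Type u} [AddCommGroup M] [Module ℂ M] {a b c : Submodule ℂ M}
    (h0 : Disjoint a (b ⊔ c)) (h1 : Disjoint b (a ⊔ c)) (h2 : Disjoint c (a ⊔ b)) :
    iSupIndep ![a, b, c] := by
  intro k
  have e : (⨆ j, ⨆ (_ : j ≠ k), ![a, b, c] j) ≤ ![b ⊔ c, a ⊔ c, a ⊔ b] k := by
    refine iSup_le fun j => iSup_le fun hj => ?_
    fin_cases k <;> fin_cases j <;> simp at hj ⊢
  refine Disjoint.mono_right e ?_
  fin_cases k
  · exact h0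
  · exact h1
  · exact h2

lemma isInternal : DirectSum.IsInternal
    ![nNeg.toSubmodule, cartan.toSubmodule, nPos.toSubmodule] := by
  apply DirectSum.isInternal_submodule_of_iSupIndep_of_iSup_eq_top
  · refine iSupIndep_three ?_ ?_ ?_
    · refine disjoint_iff_inf_le.2 ?_
      rintro x ⟨hx, hx'⟩
      obtain ⟨s, hs, t, ht, rfl⟩ := Submodule.mem_sup.1 hx'
      replace hx := (mem_nNeg_iff _).1 hx
      replace hs := (mem_cartan_iff _).1 hs
      replace ht := (mem_nPos_iff _).1 ht
      rw [Submodule.mem_bot]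
      ext i
      · rcases lt_or_ge i 0 with h | h
        · simp [hs i h.ne, ht.1 i h.le]
        · exact hx.1 i h
      · exact hx.2
    · refine disjoint_iff_inf_le.2 ?_
      rintro x ⟨hx, hx'⟩
      obtain ⟨s, hs, t, ht, rfl⟩ := Submodule.mem_sup.1 hx'
      replace hx := (mem_cartan_iff _).1 hx
      replace hs := (mem_nNeg_iff _).1 hs
      replace ht := (mem_nPos_iff _).1 ht
      rw [Submodule.mem_bot]
      ext i
      · by_cases h : i = 0
        · subst h
          simp [hs.1 0 le_rfl, ht.1 0 le_rfl]
        · exact hx i h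
      · simp [hs.2, ht.2]
    · refine disjoint_iff_inf_le.2 ?_
      rintro x ⟨hx, hx'⟩
      obtain ⟨s, hs, t, ht, rfl⟩ := Submodule.mem_sup.1 hx'
      replace hx := (mem_nPos_iff _).1 hx
      replace hs := (mem_nNeg_iff _).1 hs
      replace ht := (mem_cartan_iff _).1 ht
      rw [Submodule.mem_bot]
      ext i
      · rcases le_or_gt i 0 with h | h
        · exact hx.1 i h
        · simp [hs.1 i h.le, ht i h.ne']
      · exact hx.2
  · rw [eq_top_iff]
    rintro x -
    have e1 : x = ⟨x.coeff.filter (· < 0), 0⟩ + (⟨x.coeff.filter (· = 0), x.central⟩ +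
        ⟨x.coeff.filter (0 < ·), 0⟩) := by
      ext i
      · simp only [coeff_add, Finsupp.add_apply, Finsupp.filter_apply]
        rcases lt_trichotomy i 0 with h | h | h
        · simp [h, h.ne, h.not_gt]
        · simp [h]
        · simp [h, h.ne', h.not_gt]
      · simp
    rw [e1]
    refine add_mem ?_ (add_mem ?_ ?_)
    · refine Submodule.mem_iSup_of_mem (0 : Fin 3) ((mem_nNeg_iff _).2 ⟨fun i hi => ?_, rfl⟩)
      exact Finsupp.filter_apply_neg _ _ hi.not_gt
    · refine Submodule.mem_iSup_of_mem (1 : Fin 3) ((mem_cartan_iff _).2 fun i hi => ?_)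
      exact Finsupp.filter_apply_neg _ _ hi
    · refine Submodule.mem_iSup_of_mem (2 : Fin 3) ((mem_nPos_iff _).2 ⟨fun i hi => ?_, rfl⟩)
      exact Finsupp.filter_apply_neg _ _ hi.not_gt

lemma eq_sum {x : Virasoro} (hx : x ∈ nPos) : x = x.coeff.sum fun i a => a • e i := by
  have hx2 : x.central = 0 := hx.2
  ext1
  · change _ = coeffₗ _
    rw [map_finsuppSum]
    have : ∀ (i : ℤ) (a : ℂ), coeffₗ (a • e i) = Finsupp.single i a := fun i a => by
      rw [map_smul]
      exact Finsupp.smul_single_one i a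
    simp only [this, Finsupp.sum_single]
  · rw [hx2]
    change _ = centralₗ _
    rw [map_finsuppSum]
    have : ∀ (i : ℤ) (a : ℂ), centralₗ (a • e i) = 0 := fun i a => by
      rw [map_smul]
      exact mul_zero a
    simp only [this, Finsupp.sum, Finset.sum_const_zero]

lemma weight_decomposition : nPos.toSubmodule =
    ⨆ α ∈ {α : Dual ℂ cartan | α ∈ AddSubmonoid.closure {simpleRoot} ∧ α ≠ 0},
      nPos.toSubmodule ⊓ adWeightSpace cartan α := by
  apply le_antisymm
  · intro x hx
    rw [eq_sum hx]
    refine Submodule.sum_mem _ fun i hi => Submodule.smul_mem _ _ ?_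
    have hi0 : 0 < i := hx.1 hi
    obtain ⟨n, rfl⟩ := Int.eq_ofNat_of_zero_le hi0.le
    have hne : n • simpleRoot ≠ 0 := by
      intro h
      have h1 : (n • simpleRoot) ⟨e 0, e_zero_mem_cartan⟩ = 0 := by
        rw [h, LinearMap.zero_apply]
      rw [LinearMap.smul_apply, simpleRoot_e_zero, nsmul_eq_mul, mul_one,
        Nat.cast_eq_zero] at h1
      omega
    have hcl : n • simpleRoot ∈ AddSubmonoid.closure {simpleRoot} :=
      nsmul_mem (AddSubmonoid.subset_closure (Set.mem_singleton _)) n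
    have hle := le_iSup₂ (f := fun (α : Dual ℂ cartan)
      (_ : α ∈ {α : Dual ℂ cartan | α ∈ AddSubmonoid.closure {simpleRoot} ∧ α ≠ 0}) =>
        nPos.toSubmodule ⊓ adWeightSpace cartan α) (n • simpleRoot) ⟨hcl, hne⟩
    exact hle (Submodule.mem_inf.2 ⟨e_mem_nPos hi0, e_mem_adWeightSpace n⟩)
  · exact iSup₂_le fun _ _ => inf_le_left

/-- The standard triangular decomposition of the Virasoro algebra. -/
def triangularDecomposition : TriangularDecomposition Virasoro where
  cartan := cartan
  nPos := nPos
  nNeg := nNeg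
  simpleRoots := {simpleRoot}
  sigma := sigma
  cartan_abelian := by
    intro x hx y hy
    ext1
    · rw [coeff_lie, cartan_eq hx, cartan_eq hy, wittBracket_single]
      simp
    · exact cocycle_eq_zero (by rintro i rfl j rfl; simp) hx hy
  linearIndependent := by
    rw [linearIndepOn_singleton_iff]
    intro h
    have h1 := simpleRoot_e_zero
    rw [show simpleRoot = 0 from h, LinearMap.zero_apply] at h1
    exact zero_ne_one h1
  weight_decomposition := weight_decomposition
  sigma_sigma := sigma_sigma
  sigma_lie := sigma_lie
  sigma_cartan := by
    intro x hx
    ext i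
    · rw [sigma_coeff]
      by_cases h : i = 0
      · simp [h]
      · rw [(mem_cartan_iff x).1 hx i h, (mem_cartan_iff x).1 hx (-i) (neg_ne_zero.2 h)]
    · rfl
  sigma_nPos := by
    have h1 : ∀ x ∈ nPos, sigma x ∈ nNeg := fun x hx => by
      rw [mem_nPos_iff] at hx
      exact (mem_nNeg_iff _).2 ⟨fun i hi => by rw [sigma_coeff]; exact hx.1 _ (by omega), hx.2⟩
    have h2 : ∀ x ∈ nNeg, sigma x ∈ nPos := fun x hx => by
      rw [mem_nNeg_iff] at hx
      exact (mem_nPos_iff _).2 ⟨fun i hi => by rw [sigma_coeff]; exact hx.1 _ (by omega), hx.2⟩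
    apply le_antisymm
    · rintro _ ⟨x, hx, rfl⟩
      exact h1 x hx
    · intro x hx
      exact ⟨sigma x, h2 x hx, sigma_sigma x⟩
  isInternal := isInternal

end Virasoro

end WhittakerPairs

end

universe u

open WhittakerPairs

noncomputable section

namespace WhittakerPairs

open LieAlgebra Module

universe v

attribute [local instance 100] LieRing.ofAssociativeRing

/-! ## Universal enveloping algebras and induced modules -/

section Enveloping

variable {L : Type u} [LieRing L] [LieAlgebra ℂ L]

/-! Write `n` for `n₊` and `b` for `h ⊕ n₋`, so that `g = n ⊕ b`.

One-dimensionality: a Whittaker vector of type `λ` in the dual of a lowest weight Verma module is a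
functional `f` with `f(xm) = -λ(x) f(m)` for `x ∈ n`. The Verma module is generated over `n` by its
lowest weight vector, so `f` is determined by its value there. A nonzero `f` exists because the
Verma module maps onto `U(n)` with the generator going to `1`, and `-λ` extends to an algebra
homomorphism `U(n) → ℂ`. No PBW theorem is needed: `exists_action_enveloping` puts the required
`g`-action on `U(n)` directly, and `submodule_eq_top_of_isCompl` gives generation over `n`.

Simplicity: `n` acts nilpotently on `g/n` in a strong sense. For every `y` there is a `d` such that
any `d` successive brackets with elements of `n` bring `y` into `n` (`exists_mem_depthFiltration`).
This holds because brackets with `n` raise the height of weights, and the heights on `n₋` are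
negative integers. Consequently every vector of an image of `M_λ` is killed by all products of `k`
factors `x - λ(x)`, for some `k` (`exists_mem_whittakerFiltration`). A nonzero submodule of the
image then contains a nonzero vector of `W_λ`: take a nonzero vector of least level. As `W_λ` is a
line spanned by the image of the generator, the submodule is everything. The same nilpotency leaves
`λ(x)` as the only possible eigenvalue of `x`, so every Whittaker vector has type `λ`.

Local finiteness for the Virasoro algebra is a separate point: each element of `g` has to lie in a
finite-dimensional subspace that is `n`-stable modulo `n`. -/

lemma subalgebra_eq_top_of_ι_mem (A : Subalgebra ℂ (UniversalEnvelopingAlgebra ℂ L))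
    (h : ∀ x, UniversalEnvelopingAlgebra.ι ℂ x ∈ A) : A = ⊤ := by
  let f : L →ₗ⁅ℂ⁆ A :=
    { toFun := fun x => ⟨UniversalEnvelopingAlgebra.ι ℂ x, h x⟩
      map_add' := fun x y => Subtype.ext (map_add _ x y)
      map_smul' := fun c x => Subtype.ext (map_smul _ c x)
      map_lie' := fun {x y} => Subtype.ext (LieHom.map_lie _ x y) }
  -- The lift of `f` followed by the inclusion of `A` agrees with the identity on the generators,
  -- hence is the identity.
  have e : A.val.comp (UniversalEnvelopingAlgebra.lift ℂ f) = AlgHom.id ℂ _ := by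
    apply UniversalEnvelopingAlgebra.hom_ext
    ext x
    change A.val (UniversalEnvelopingAlgebra.lift ℂ f (UniversalEnvelopingAlgebra.ι ℂ x)) = _
    rw [UniversalEnvelopingAlgebra.lift_ι_apply]
    rfl
  rw [eq_top_iff]
  rintro u -
  have := DFunLike.congr_fun e u
  rw [AlgHom.id_apply] at this
  rw [← this]
  exact (UniversalEnvelopingAlgebra.lift ℂ f u).2

lemma submodule_eq_top_of_ι_mul_mem (S : Submodule ℂ (UniversalEnvelopingAlgebra ℂ L))
    (h1 : 1 ∈ S) (h : ∀ x, ∀ u ∈ S, UniversalEnvelopingAlgebra.ι ℂ x * u ∈ S) : S = ⊤ := by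
  -- The elements whose left multiplication preserves `S` form a subalgebra; once it is everything,
  -- apply it to `1 ∈ S`.
  let A : Subalgebra ℂ (UniversalEnvelopingAlgebra ℂ L) :=
    { carrier := {u | ∀ s ∈ S, u * s ∈ S}
      mul_mem' := fun {a b} ha hb s hs => by
        rw [mul_assoc]
        exact ha _ (hb s hs)
      add_mem' := fun {a b} ha hb s hs => by
        rw [add_mul]
        exact add_mem (ha s hs) (hb s hs)
      algebraMap_mem' := fun c s hs => by
        rw [← Algebra.smul_def]
        exact S.smul_mem c hs }
  have hA := subalgebra_eq_top_of_ι_mem A h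
  rw [eq_top_iff]
  rintro u -
  have hu : u ∈ A := hA ▸ Algebra.mem_top
  simpa using hu 1 h1

end Enveloping

namespace Induced

variable {g : Type u} [LieRing g] [LieAlgebra ℂ g] (p : LieSubalgebra ℂ g) (χ : LieCharacter ℂ p)

lemma lie_generator (x : p) : ⁅(x : g), generator p χ⁆ = χ x • generator p χ := by
  rw [lie_def, ← algebraMap_smul (UniversalEnvelopingAlgebra ℂ g) (χ x), ← sub_eq_zero,
    ← sub_smul]
  change Submodule.mkQ (inducedIdeal p χ)
    ((UniversalEnvelopingAlgebra.ι ℂ (x : g) - algebraMap ℂ _ (χ x)) * 1) = 0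
  rw [mul_one, Submodule.mkQ_apply, Submodule.Quotient.mk_eq_zero]
  exact Submodule.subset_span ⟨x, rfl⟩

variable {p χ} in
lemma submodule_eq_top (S : Submodule ℂ (Induced p χ)) (h1 : generator p χ ∈ S)
    (h : ∀ x : g, ∀ m ∈ S, ⁅x, m⁆ ∈ S) : S = ⊤ := by
  have key := submodule_eq_top_of_ι_mul_mem
    (S.comap ((Submodule.mkQ (inducedIdeal p χ)).restrictScalars ℂ)) h1 fun x u hu => h x _ hu
  rw [eq_top_iff]
  rintro m -
  obtain ⟨u, rfl⟩ := Submodule.mkQ_surjective (inducedIdeal p χ) m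
  have : u ∈ (⊤ : Submodule ℂ (UniversalEnvelopingAlgebra ℂ g)) := trivial
  rw [← key] at this
  exact this

variable {V : Type v} [AddCommGroup V] [Module ℂ V] [LieRingModule g V] [LieModule ℂ g V]

omit [LieModule ℂ g V] in
variable {p χ} in
lemma hom_ext {φ ψ : Induced p χ →ₗ⁅ℂ, g⁆ V} (h : φ (generator p χ) = ψ (generator p χ)) :
    φ = ψ := by
  have key := submodule_eq_top (LinearMap.eqLocus (φ : Induced p χ →ₗ[ℂ] V) ψ) h
    fun x m hm => by
      change φ ⁅x, m⁆ = ψ ⁅x, m⁆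
      rw [LieModuleHom.map_lie, LieModuleHom.map_lie]
      exact congrArg _ hm
  ext m
  have : m ∈ (⊤ : Submodule ℂ (Induced p χ)) := trivial
  rw [← key] at this
  exact this

/-- The universal property of the induced module. -/
lemma exists_hom (w : V) (hw : ∀ x : p, ⁅(x : g), w⁆ = χ x • w) :
    ∃ φ : Induced p χ →ₗ⁅ℂ, g⁆ V, φ (generator p χ) = w := by
  let T := UniversalEnvelopingAlgebra.lift ℂ (LieModule.toEnd ℂ g V)
  -- The orbit map `u ↦ u w`; it kills the defining left ideal and so descends to the quotient.
  let f : UniversalEnvelopingAlgebra ℂ g →ₗ[ℂ] V := (LinearMap.applyₗ w) ∘ₗ T.toLinearMap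
  have hf : (inducedIdeal p χ).restrictScalars ℂ ≤ LinearMap.ker f := by
    intro u hu
    have hu' : u ∈ inducedIdeal p χ := hu
    change T u w = 0
    induction hu' using Submodule.span_induction with
    | zero => simp
    | add a b ha hb h1 h2 => rw [map_add, LinearMap.add_apply, h1 ha, h2 hb, add_zero]
    | smul a b hb h2 => rw [smul_eq_mul, map_mul, Module.End.mul_apply, h2 hb, map_zero]
    | mem a ha =>
      obtain ⟨x, rfl⟩ := ha
      rw [map_sub, LinearMap.sub_apply, UniversalEnvelopingAlgebra.lift_ι_apply,
        AlgHom.commutes, LieModule.toEnd_apply_apply, hw, Module.algebraMap_end_apply, sub_self]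
  let F : Induced p χ →ₗ[ℂ] V := (Submodule.liftQ _ f hf) ∘ₗ
    (Submodule.Quotient.restrictScalarsEquiv ℂ (inducedIdeal p χ)).symm.toLinearMap
  have hF : ∀ u, F (Submodule.mkQ (inducedIdeal p χ) u) = T u w := fun u => rfl
  refine ⟨{ F with map_lie' := ?_ }, ?_⟩
  · intro x m
    obtain ⟨u, rfl⟩ := Submodule.mkQ_surjective (inducedIdeal p χ) m
    change F (Submodule.mkQ (inducedIdeal p χ) (UniversalEnvelopingAlgebra.ι ℂ x * u)) =
      ⁅x, F (Submodule.mkQ (inducedIdeal p χ) u)⁆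
    rw [hF, hF, map_mul, Module.End.mul_apply, UniversalEnvelopingAlgebra.lift_ι_apply,
      LieModule.toEnd_apply_apply]
  · change F (Submodule.mkQ (inducedIdeal p χ) 1) = w
    rw [hF, map_one, Module.End.one_apply]

end Induced

/-! ## Whittaker functionals for a decomposition into two subalgebras -/

section TwoSubalgebras

variable {g : Type u} [LieRing g] [LieAlgebra ℂ g]

/-- A representation of `g = a ⊕ b` on `U(a)` that extends the left multiplication by `a` and for
which `b` acts on `1` through the character `χ`. -/
lemma exists_action_enveloping (a b : LieSubalgebra ℂ g)
    (hab : IsCompl a.toSubmodule b.toSubmodule) (χ : LieCharacter ℂ b) :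
    ∃ ρ : g →ₗ⁅ℂ⁆ Module.End ℂ (UniversalEnvelopingAlgebra ℂ a),
      (∀ (x : a) u, ρ x u = UniversalEnvelopingAlgebra.ι ℂ x * u) ∧
      ∀ y : b, ρ y 1 = χ y • 1 := by
  let Ua := UniversalEnvelopingAlgebra ℂ a
  let i := UniversalEnvelopingAlgebra.ι ℂ (L := a)
  -- In the representation to be built, `y(xu) = x(yu) - [x, y]u` for `x ∈ a`. Thus the map `φ : y ↦
  -- yu` determines `y ↦ y(xu)`, and `act x` is this passage. That `act` respects brackets is the
  -- Jacobi identity.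
  let act : a →ₗ⁅ℂ⁆ Module.End ℂ (g →ₗ[ℂ] Ua) :=
    { toFun := fun x =>
        { toFun := fun φ => LinearMap.mulLeft ℂ (i x) ∘ₗ φ - φ ∘ₗ (LieAlgebra.ad ℂ g (x : g))
          map_add' := fun φ ψ => by
            ext y
            simp [mul_add]
            abel
          map_smul' := fun c φ => by
            ext y
            simp [smul_sub] }
      map_add' := fun x y => by
        ext φ z
        simp [add_mul]
        abel
      map_smul' := fun c x => by
        ext φ z
        simp [smul_sub]
      map_lie' := fun {x y} => by
        ext φ z
        simp only [LieRing.of_associative_ring_bracket, LinearMap.sub_apply, Module.End.mul_apply,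
          LinearMap.coe_mk, AddHom.coe_mk, LinearMap.comp_apply, LinearMap.mulLeft_apply,
          LieHom.map_lie, LieAlgebra.ad_apply, LieSubalgebra.coe_bracket, map_sub,
          sub_mul, mul_assoc]
        abel }
  have act_apply : ∀ x φ y, act x φ y = i x * φ y - φ ⁅(x : g), y⁆ := fun x φ y => rfl
  -- The prescribed values `y ↦ y · 1`: the inclusion into `U(a)` on `a`, the character `χ` on `b`.
  let φ₀ : g →ₗ[ℂ] Ua :=
    (i : a →ₗ[ℂ] Ua) ∘ₗ (Submodule.projectionOnto _ _ hab) +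
      (Algebra.linearMap ℂ Ua) ∘ₗ (χ : b →ₗ[ℂ] ℂ) ∘ₗ (Submodule.projectionOnto _ _ hab.symm)
  have φ₀_a : ∀ x : a, φ₀ x = i x := fun x => by
    have h1 : Submodule.projectionOnto _ _ hab (x : g) = x :=
      Submodule.projectionOnto_apply_left hab x
    have h2 : Submodule.projectionOnto _ _ hab.symm (x : g) = 0 :=
      Submodule.projectionOnto_apply_of_mem_right hab.symm x.2
    change i (Submodule.projectionOnto _ _ hab (x : g)) +
      algebraMap ℂ Ua (χ (Submodule.projectionOnto _ _ hab.symm (x : g))) = _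
    rw [h1, h2, map_zero, map_zero, add_zero]
  have φ₀_b : ∀ y : b, φ₀ y = algebraMap ℂ Ua (χ y) := fun y => by
    have h1 : Submodule.projectionOnto _ _ hab.symm (y : g) = y :=
      Submodule.projectionOnto_apply_left hab.symm y
    have h2 : Submodule.projectionOnto _ _ hab (y : g) = 0 :=
      Submodule.projectionOnto_apply_of_mem_right hab y.2
    change i (Submodule.projectionOnto _ _ hab (y : g)) +
      algebraMap ℂ Ua (χ (Submodule.projectionOnto _ _ hab.symm (y : g))) = _
    rw [h1, h2, map_zero, zero_add]
  -- `Φ u y` is to be the result of `y` acting on `u`.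
  let Φ : Ua →ₗ[ℂ] g →ₗ[ℂ] Ua :=
    (LinearMap.applyₗ φ₀) ∘ₗ (UniversalEnvelopingAlgebra.lift ℂ act).toLinearMap
  have Φ_one : Φ 1 = φ₀ := by
    change UniversalEnvelopingAlgebra.lift ℂ act 1 φ₀ = φ₀
    rw [map_one, Module.End.one_apply]
  have Φ_mul : ∀ x u y, Φ (i x * u) y = i x * Φ u y - Φ u ⁅(x : g), y⁆ := fun x u y => by
    change UniversalEnvelopingAlgebra.lift ℂ act (i x * u) φ₀ y = _
    rw [map_mul, Module.End.mul_apply, UniversalEnvelopingAlgebra.lift_ι_apply, act_apply]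
    rfl
  have Φ_a : ∀ u, ∀ x : a, Φ u x = i x * u := by
    intro u
    have key := submodule_eq_top_of_ι_mul_mem
      (⨅ x : a, LinearMap.eqLocus ((LinearMap.applyₗ (x : g)) ∘ₗ Φ) (LinearMap.mulLeft ℂ (i x)))
      (by
        rw [Submodule.mem_iInf]
        intro x
        change Φ 1 x = i x * 1
        rw [Φ_one, φ₀_a, mul_one])
      (by
        intro y u hu
        rw [Submodule.mem_iInf] at hu ⊢
        replace hu : ∀ x : a, Φ u x = i x * u := hu
        intro x
        change Φ (i y * u) x = i x * (i y * u)
        have e : ⁅(y : g), (x : g)⁆ = (⁅y, x⁆ : a) := rfl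
        rw [Φ_mul, hu, e, hu, LieHom.map_lie, LieRing.of_associative_ring_bracket, sub_mul,
          mul_assoc, mul_assoc]
        abel)
    have hu : u ∈ (⊤ : Submodule ℂ Ua) := trivial
    rw [← key, Submodule.mem_iInf] at hu
    exact hu
  -- If one of `y`, `z` lies in `a`, the relation is a form of `Φ_mul`. In general, induct on `u`.
  -- For `u = 1` this leaves only `y, z ∈ b`, where both sides vanish because `χ` is a character;
  -- the passage from `u` to `xu` is the Jacobi identity.
  have Φ_lie : ∀ u y z, Φ u ⁅y, z⁆ = Φ (Φ u z) y - Φ (Φ u y) z := by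
    intro u
    have step_a : ∀ u, ∀ x : a, ∀ z, Φ u ⁅(x : g), z⁆ = Φ (Φ u z) x - Φ (Φ u x) z := by
      intro u x z
      rw [Φ_a, Φ_a, Φ_mul]
      abel
    have step_a' : ∀ u, ∀ x : a, ∀ z, Φ u ⁅z, (x : g)⁆ = Φ (Φ u x) z - Φ (Φ u z) x := by
      intro u x z
      rw [← lie_skew, map_neg, step_a]
      abel
    have decomp : ∀ y : g, ∃ (s : a) (t : b), y = s + t := fun y => by
      have hy : y ∈ a.toSubmodule ⊔ b.toSubmodule := hab.sup_eq_top ▸ Submodule.mem_top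
      obtain ⟨s, hs, t, ht, rfl⟩ := Submodule.mem_sup.1 hy
      exact ⟨⟨s, hs⟩, ⟨t, ht⟩, rfl⟩
    let S : Submodule ℂ Ua :=
      { carrier := {u | ∀ y z, Φ u ⁅y, z⁆ = Φ (Φ u z) y - Φ (Φ u y) z}
        add_mem' := fun {u v} hu hv y z => by
          simp only [map_add, LinearMap.add_apply, hu y z, hv y z]
          abel
        zero_mem' := fun y z => by simp
        smul_mem' := fun c u hu y z => by
          simp only [map_smul, LinearMap.smul_apply, hu y z, smul_sub] }
    have key : S = ⊤ := by
      apply submodule_eq_top_of_ι_mul_mem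
      · intro y z
        obtain ⟨s, t, rfl⟩ := decomp y
        rw [add_lie, map_add, map_add, map_add, step_a, map_add, LinearMap.add_apply]
        have : Φ 1 ⁅(t : g), z⁆ = Φ (Φ 1 z) t - Φ (Φ 1 t) z := by
          obtain ⟨s', t', rfl⟩ := decomp z
          rw [lie_add, map_add, map_add, map_add, step_a', map_add, LinearMap.add_apply]
          have : Φ 1 ⁅(t : g), (t' : g)⁆ = Φ (Φ 1 t') t - Φ (Φ 1 t) t' := by
            have e : ⁅(t : g), (t' : g)⁆ = (⁅t, t'⁆ : b) := rfl
            have e1 : ∀ (c : ℂ) (y : g), Φ (algebraMap ℂ Ua c) y = c • φ₀ y := fun c y => by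
              rw [Algebra.algebraMap_eq_smul_one, map_smul, Φ_one, LinearMap.smul_apply]
            rw [Φ_one, e, φ₀_b, φ₀_b, φ₀_b, e1, e1, φ₀_b, φ₀_b, lieCharacter_apply_lie,
              map_zero, Algebra.algebraMap_eq_smul_one, Algebra.algebraMap_eq_smul_one (χ t'),
              smul_smul, smul_smul, mul_comm, sub_self]
          rw [this]
          abel
        rw [this]
        abel
      · intro x u hu y z
        replace hu : ∀ y z, Φ u ⁅y, z⁆ = Φ (Φ u z) y - Φ (Φ u y) z := hu
        have j : ⁅(x : g), ⁅y, z⁆⁆ = ⁅⁅(x : g), y⁆, z⁆ + ⁅y, ⁅(x : g), z⁆⁆ := leibniz_lie _ _ _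
        rw [Φ_mul, Φ_mul, Φ_mul, j]
        simp only [map_add, map_sub, LinearMap.sub_apply, Φ_mul, hu, mul_sub]
        abel
    have hu : u ∈ S := key ▸ Submodule.mem_top
    exact hu
  refine ⟨{ Φ.flip with map_lie' := ?_ }, fun x u => Φ_a u x, fun y => ?_⟩
  · intro y z
    ext u
    exact Φ_lie u y z
  · change Φ 1 y = _
    rw [Φ_one, φ₀_b, Algebra.algebraMap_eq_smul_one]

/-- For `g = a ⊕ b`, the module induced from a character of `b` has a linear form on which `a` acts
through a given character and which does not vanish on the generator. -/
lemma exists_whittaker_functional (a b : LieSubalgebra ℂ g)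
    (hab : IsCompl a.toSubmodule b.toSubmodule) (χ : LieCharacter ℂ b) (lam : LieCharacter ℂ a) :
    ∃ f : Module.Dual ℂ (Induced b χ), f (Induced.generator b χ) = 1 ∧
      ∀ (x : a) (m : Induced b χ), f ⁅(x : g), m⁆ = lam x • f m := by
  obtain ⟨ρ, h1, h2⟩ := exists_action_enveloping a b hab χ
  let _ : LieRingModule g (UniversalEnvelopingAlgebra ℂ a) := LieRingModule.compLieHom _ ρ
  have _ : LieModule ℂ g (UniversalEnvelopingAlgebra ℂ a) := LieModule.compLieHom _ ρ
  obtain ⟨φ, hφ⟩ := Induced.exists_hom b χ (1 : UniversalEnvelopingAlgebra ℂ a) h2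
  -- Map the induced module to `U(a)` by `generator ↦ 1`, then apply the algebra homomorphism `U(a)
  -- → ℂ` extending `lam`.
  refine ⟨(UniversalEnvelopingAlgebra.lift ℂ lam).toLinearMap ∘ₗ (φ : _ →ₗ[ℂ] _), ?_, ?_⟩
  · change UniversalEnvelopingAlgebra.lift ℂ lam (φ (Induced.generator b χ)) = 1
    rw [hφ, map_one]
  · intro x m
    change UniversalEnvelopingAlgebra.lift ℂ lam (φ ⁅(x : g), m⁆) =
      lam x • UniversalEnvelopingAlgebra.lift ℂ lam (φ m)
    have e : ⁅(x : g), φ m⁆ = UniversalEnvelopingAlgebra.ι ℂ x * φ m := h1 x (φ m)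
    rw [LieModuleHom.map_lie, e, map_mul, UniversalEnvelopingAlgebra.lift_ι_apply, smul_eq_mul]

/-- For `g = a ⊕ b`, the module induced from a character of `b` is generated by its canonical
generator already as a module over `a`. -/
lemma submodule_eq_top_of_isCompl (a b : LieSubalgebra ℂ g)
    (hab : IsCompl a.toSubmodule b.toSubmodule) (χ : LieCharacter ℂ b)
    (S : Submodule ℂ (Induced b χ)) (h1 : Induced.generator b χ ∈ S)
    (h : ∀ x : a, ∀ m ∈ S, ⁅(x : g), m⁆ ∈ S) : S = ⊤ := by
  let A : LieSubmodule ℂ a (Induced b χ) := LieSubmodule.lieSpan ℂ a {Induced.generator b χ}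
  have hgen : Induced.generator b χ ∈ A := LieSubmodule.subset_lieSpan rfl
  have hA : (A : Set (Induced b χ)) ⊆ S :=
    (LieSubmodule.lieSpan_le (N := { S with lie_mem := fun {x m} hm => h x m hm })).2
      (Set.singleton_subset_iff.2 h1)
  -- The vectors of `A` that all of `g` sends into `A`. They are `a`-stable by `y(xm) = [y, x]m +
  -- x(ym)`. The generator is among them because `b` scales it, so `A` is `g`-stable.
  let B : LieSubmodule ℂ a (Induced b χ) :=
    { carrier := {m | m ∈ A ∧ ∀ y : g, ⁅y, m⁆ ∈ A}
      add_mem' := fun {m n} hm hn => ⟨add_mem hm.1 hn.1, fun y => by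
        rw [lie_add]
        exact add_mem (hm.2 y) (hn.2 y)⟩
      zero_mem' := ⟨zero_mem _, fun y => by
        rw [lie_zero]
        exact zero_mem _⟩
      smul_mem' := fun c m hm => ⟨A.smul_mem c hm.1, fun y => by
        rw [lie_smul]
        exact A.smul_mem c (hm.2 y)⟩
      lie_mem := fun {x m} hm => ⟨A.lie_mem hm.1, fun y => by
        change ⁅y, ⁅(x : g), m⁆⁆ ∈ A
        rw [leibniz_lie]
        exact add_mem (hm.2 _) (A.lie_mem (x := x) (hm.2 y))⟩ }
  have hB : A ≤ B := by
    refine LieSubmodule.lieSpan_le.2 (Set.singleton_subset_iff.2 ⟨hgen, fun y => ?_⟩)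
    have hy : y ∈ a.toSubmodule ⊔ b.toSubmodule := hab.sup_eq_top ▸ Submodule.mem_top
    obtain ⟨s, hs, t, ht, rfl⟩ := Submodule.mem_sup.1 hy
    rw [add_lie]
    refine add_mem (A.lie_mem (x := ⟨s, hs⟩) hgen) ?_
    rw [Induced.lie_generator b χ ⟨t, ht⟩]
    exact A.smul_mem _ hgen
  have htop := Induced.submodule_eq_top A.toSubmodule hgen fun y m hm => (hB hm).2 y
  rw [eq_top_iff, ← htop]
  exact hA

end TwoSubalgebras

/-! ## The filtration by nilpotency of the shifted action -/

section Filtration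

variable {g : Type u} [LieRing g] [LieAlgebra ℂ g] (n : LieSubalgebra ℂ g)

/-- The increasing sequence of subspaces of `g` that starts with `n` and such that each further
subspace consists of the elements that `n` maps to the preceding one. -/
def depthFiltration : ℕ → Submodule ℂ g
  | 0 => n.toSubmodule
  | d + 1 => ⨅ x : n, (depthFiltration d).comap (LieAlgebra.ad ℂ g (x : g) : g →ₗ[ℂ] g)

lemma mem_depthFiltration_succ {d : ℕ} {y : g} :
    y ∈ depthFiltration n (d + 1) ↔ ∀ x : n, ⁅(x : g), y⁆ ∈ depthFiltration n d := by
  rw [depthFiltration, Submodule.mem_iInf]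
  rfl

lemma depthFiltration_mono : Monotone (depthFiltration n) := by
  refine monotone_nat_of_le_succ fun d => ?_
  induction d with
  | zero =>
    intro y hy
    rw [mem_depthFiltration_succ]
    exact fun x => n.lie_mem x.2 hy
  | succ d ih =>
    intro y hy
    rw [mem_depthFiltration_succ] at hy ⊢
    exact fun x => ih (hy x)

variable {n} (lam : LieCharacter ℂ n)
variable (V : Type v) [AddCommGroup V] [Module ℂ V] [LieRingModule g V] [LieModule ℂ g V]

/-- The subspace of vectors that are annihilated by all products of `k` factors
`x - lam x`, `x ∈ n`. -/
def whittakerFiltration : ℕ → Submodule ℂ V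
  | 0 => ⊥
  | k + 1 => ⨅ x : n, (whittakerFiltration k).comap
      (LieModule.toEnd ℂ g V (x : g) - lam x • LinearMap.id)

variable {V}

lemma mem_whittakerFiltration_succ {k : ℕ} {w : V} :
    w ∈ whittakerFiltration lam V (k + 1) ↔
      ∀ x : n, ⁅(x : g), w⁆ - lam x • w ∈ whittakerFiltration lam V k := by
  rw [whittakerFiltration, Submodule.mem_iInf]
  rfl

variable (V) in
lemma whittakerFiltration_mono : Monotone (whittakerFiltration lam V) := by
  refine monotone_nat_of_le_succ fun d => ?_
  induction d with
  | zero => exact bot_le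
  | succ d ih =>
    intro y hy
    rw [mem_whittakerFiltration_succ] at hy ⊢
    exact fun x => ih (hy x)

/-- Double induction, on `d` and then on `k`, from `(x - λ(x))(yw) = [x, y]w + y((x - λ(x))w)`: the
first term has smaller `d`, the second smaller `k`. For `d = 0`, `yw` differs from `λ(y)w` by a
vector of lower level. -/
lemma lie_mem_whittakerFiltration {d : ℕ} {y : g} (hy : y ∈ depthFiltration n d) {k : ℕ} {w : V}
    (hw : w ∈ whittakerFiltration lam V k) : ⁅y, w⁆ ∈ whittakerFiltration lam V (k + d) := by
  induction d generalizing y k w with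
  | zero =>
    cases k with
    | zero =>
      obtain rfl : w = 0 := hw
      rw [lie_zero]
      exact zero_mem _
    | succ k =>
      have h1 := whittakerFiltration_mono lam V k.le_succ
        ((mem_whittakerFiltration_succ lam).1 hw ⟨y, hy⟩)
      exact (Submodule.sub_mem_iff_left _ (Submodule.smul_mem _ _ hw)).1 h1
  | succ d ihd =>
    induction k generalizing w with
    | zero =>
      obtain rfl : w = 0 := hw
      rw [lie_zero]
      exact zero_mem _
    | succ k ihk =>
      rw [← add_assoc, mem_whittakerFiltration_succ]
      intro x
      have e : ⁅(x : g), ⁅y, w⁆⁆ - lam x • ⁅y, w⁆ =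
          ⁅⁅(x : g), y⁆, w⁆ + ⁅y, ⁅(x : g), w⁆ - lam x • w⁆ := by
        rw [leibniz_lie, lie_sub, lie_smul]
        abel
      rw [e]
      refine add_mem (ihd ((mem_depthFiltration_succ n).1 hy x) hw) ?_
      have := ihk ((mem_whittakerFiltration_succ lam).1 hw x)
      rwa [← add_assoc, add_right_comm] at this

/-- A module homomorphism from the module induced from a character of `n` has values in the union
of the filtration. -/
lemma exists_mem_whittakerFiltration (hn : ∀ y : g, ∃ d, y ∈ depthFiltration n d)
    (φ : Induced n lam →ₗ⁅ℂ, g⁆ V) (m : Induced n lam) :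
    ∃ k, φ m ∈ whittakerFiltration lam V k := by
  let S : Submodule ℂ (Induced n lam) :=
    { carrier := {m | ∃ k, φ m ∈ whittakerFiltration lam V k}
      add_mem' := by
        rintro a b ⟨k, hk⟩ ⟨l, hl⟩
        refine ⟨max k l, ?_⟩
        rw [map_add]
        exact add_mem (whittakerFiltration_mono lam V (le_max_left _ _) hk)
          (whittakerFiltration_mono lam V (le_max_right _ _) hl)
      zero_mem' := ⟨0, by
        rw [map_zero]
        exact zero_mem _⟩
      smul_mem' := by
        rintro c a ⟨k, hk⟩
        refine ⟨k, ?_⟩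
        rw [map_smul]
        exact Submodule.smul_mem _ _ hk }
  have hS : S = ⊤ := by
    -- Level `1` is `W_λ`, and it contains the image of the generator.
    refine Induced.submodule_eq_top S ⟨1, ?_⟩ ?_
    · rw [mem_whittakerFiltration_succ]
      intro x
      rw [← LieModuleHom.map_lie, Induced.lie_generator, map_smul, sub_self]
      exact zero_mem _
    · rintro y m ⟨k, hk⟩
      obtain ⟨d, hd⟩ := hn y
      refine ⟨k + d, ?_⟩
      rw [LieModuleHom.map_lie]
      exact lie_mem_whittakerFiltration lam hd hk
  have hm : m ∈ S := hS ▸ Submodule.mem_top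
  exact hm

/-- On an eigenvector, `x - λ(x)` is multiplication by `c - λ(x)`, and `k` such factors kill `w`. -/
lemma pow_smul_eq_zero_of_lie_eq_smul {k : ℕ} {w : V} (hw : w ∈ whittakerFiltration lam V k)
    {x : n} {c : ℂ} (hx : ⁅(x : g), w⁆ = c • w) : (c - lam x) ^ k • w = 0 := by
  induction k generalizing w with
  | zero =>
    obtain rfl : w = 0 := hw
    rw [smul_zero]
  | succ k ih =>
    have h1 := (mem_whittakerFiltration_succ lam).1 hw x
    rw [hx, ← sub_smul] at h1
    have h2 := ih h1 (by rw [lie_smul, hx, smul_comm])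
    rwa [smul_smul, ← pow_succ] at h2

end Filtration

namespace TriangularDecomposition

/-! ### Simplicity and Whittaker vectors of the images of standard Whittaker modules -/

section Simplicity

variable {g : Type u} [LieRing g] [LieAlgebra ℂ g] (D : TriangularDecomposition g)
variable {V : Type v} [AddCommGroup V] [Module ℂ V] [LieRingModule g V] [LieModule ℂ g V]
variable {lam : LieCharacter ℂ D.nPos}

lemma generator_mem_whittakerSpace (φ : D.StandardWhittaker lam →ₗ⁅ℂ, g⁆ V) :
    φ (Induced.generator D.nPos lam) ∈ D.whittakerSpace V lam := by
  intro x
  rw [← LieModuleHom.map_lie, Induced.lie_generator, map_smul]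

omit [LieModule ℂ g V] in
lemma map_generator_ne_zero {φ : D.StandardWhittaker lam →ₗ⁅ℂ, g⁆ V} (hφ : φ ≠ 0) :
    φ (Induced.generator D.nPos lam) ≠ 0 := by
  intro h
  exact hφ (Induced.hom_ext (by rw [h, LieModuleHom.zero_apply]))

lemma existsUnique_hom {w : V} (hw : w ∈ D.whittakerSpace V lam) :
    ∃! φ : D.StandardWhittaker lam →ₗ⁅ℂ, g⁆ V, φ (Induced.generator D.nPos lam) = w := by
  obtain ⟨φ, hφ⟩ := Induced.exists_hom D.nPos lam w hw
  exact ⟨φ, hφ, fun ψ hψ => Induced.hom_ext (hψ.trans hφ.symm)⟩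

omit [LieModule ℂ g V] in
/-- A submodule of the image of `φ` that contains the image of the generator is everything. -/
lemma lieSubmodule_range_eq_top (φ : D.StandardWhittaker lam →ₗ⁅ℂ, g⁆ V)
    (N : Submodule ℂ φ.range) (hN : ∀ x : g, ∀ w ∈ N, ⁅x, w⁆ ∈ N)
    (h : ⟨φ (Induced.generator D.nPos lam), (φ.mem_range _).2 ⟨_, rfl⟩⟩ ∈ N) : N = ⊤ := by
  let F : D.StandardWhittaker lam →ₗ[ℂ] φ.range :=
    LinearMap.codRestrict φ.range.toSubmodule (φ : D.StandardWhittaker lam →ₗ[ℂ] V)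
      fun m => (φ.mem_range _).2 ⟨m, rfl⟩
  have hF : ∀ x m, F ⁅x, m⁆ = ⁅x, F m⁆ := fun x m => Subtype.ext (LieModuleHom.map_lie φ x m)
  have key := Induced.submodule_eq_top (N.comap F) h fun x m hm => by
    rw [Submodule.mem_comap, hF]
    exact hN x _ hm
  rw [eq_top_iff]
  rintro ⟨w, hw⟩ -
  obtain ⟨m, rfl⟩ := (φ.mem_range _).1 hw
  have hm : m ∈ (⊤ : Submodule ℂ (D.StandardWhittaker lam)) := trivial
  rw [← key] at hm
  exact hm

/-- The Whittaker space of the image embeds in that of `V`, which is a line, and it contains the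
nonzero image of the generator. -/
lemma finrank_whittakerSpace_range (hV : finrank ℂ (D.whittakerSpace V lam) = 1)
    {φ : D.StandardWhittaker lam →ₗ⁅ℂ, g⁆ V} (hφ : φ ≠ 0) :
    finrank ℂ (D.whittakerSpace φ.range lam) = 1 := by
  let w₀ : D.whittakerSpace V lam := ⟨_, D.generator_mem_whittakerSpace φ⟩
  have hw₀ : w₀ ≠ 0 := fun h => D.map_generator_ne_zero hφ (congrArg Subtype.val h)
  have h1 := (finrank_eq_one_iff_of_nonzero' w₀ hw₀).1 hV
  refine finrank_eq_one (⟨⟨w₀, (φ.mem_range _).2 ⟨_, rfl⟩⟩, fun x => Subtype.ext (w₀.2 x)⟩ :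
    D.whittakerSpace φ.range lam) (fun h => hw₀ ?_) ?_
  · exact Subtype.ext (congrArg (fun w : D.whittakerSpace φ.range lam => (w : V)) h)
  · rintro ⟨⟨w, hw⟩, hw'⟩
    obtain ⟨c, hc⟩ := h1 ⟨w, fun x => congrArg Subtype.val (hw' x)⟩
    exact ⟨c, Subtype.ext (Subtype.ext
      (congrArg (fun w : D.whittakerSpace V lam => (w : V)) hc))⟩

lemma isIrreducible_range (hn : ∀ y : g, ∃ d, y ∈ depthFiltration D.nPos d)
    (hV : finrank ℂ (D.whittakerSpace V lam) = 1)
    {φ : D.StandardWhittaker lam →ₗ⁅ℂ, g⁆ V} (hφ : φ ≠ 0) :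
    LieModule.IsIrreducible ℂ g φ.range := by
  let w₀ : D.whittakerSpace V lam := ⟨_, D.generator_mem_whittakerSpace φ⟩
  have hw₀ : w₀ ≠ 0 := fun h => D.map_generator_ne_zero hφ (congrArg Subtype.val h)
  have h1 := (finrank_eq_one_iff_of_nonzero' w₀ hw₀).1 hV
  have : Nontrivial φ.range :=
    ⟨⟨⟨w₀, (φ.mem_range _).2 ⟨_, rfl⟩⟩, 0, fun h => hw₀ (Subtype.ext
      (congrArg (fun w : φ.range => (w : V)) h))⟩⟩
  refine LieModule.IsIrreducible.mk fun N hN => ?_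
  -- Choose a nonzero vector of `N` in the least possible level of the filtration. Level `0` is
  -- zero. At level `k + 1` the vectors `(x - λ(x))w` lie in `N` and in level `k`, so minimality
  -- makes them vanish and `w` is a Whittaker vector.
  have hex : ∃ k, ∃ w ∈ N, w ≠ 0 ∧ (w : V) ∈ whittakerFiltration lam V k := by
    obtain ⟨w, hw, hw0⟩ := (Submodule.ne_bot_iff _).1
      (fun h => hN ((LieSubmodule.toSubmodule_eq_bot N).1 h))
    obtain ⟨m, hm⟩ := (φ.mem_range _).1 w.2
    obtain ⟨k, hk⟩ := exists_mem_whittakerFiltration lam hn φ m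
    exact ⟨k, w, hw, hw0, hm ▸ hk⟩
  classical
  obtain ⟨w, hwN, hw0, hwk⟩ := Nat.find_spec hex
  have hmin := fun l => Nat.find_min hex (m := l)
  generalize Nat.find hex = k at hwk hmin
  cases k with
  | zero => exact absurd (Subtype.ext (show (w : V) = 0 from hwk)) hw0
  | succ k =>
    have hwW : (w : V) ∈ D.whittakerSpace V lam := by
      intro x
      by_contra hne
      refine hmin k k.lt_succ_self ⟨⁅(x : g), w⁆ - lam x • w, ?_, ?_, ?_⟩
      · exact sub_mem (N.lie_mem hwN) (N.smul_mem _ hwN)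
      · intro h
        exact hne (sub_eq_zero.1 (congrArg Subtype.val h))
      · exact (mem_whittakerFiltration_succ lam).1 hwk x
    -- Since `W_λ(V)` is a line, the image of the generator is a multiple of `w`, hence in `N`.
    obtain ⟨c, hc⟩ := (finrank_eq_one_iff_of_nonzero' ⟨_, hwW⟩
      (fun h => hw0 (Subtype.ext
        (congrArg (fun w : D.whittakerSpace V lam => (w : V)) h)))).1 hV w₀
    have htop := D.lieSubmodule_range_eq_top φ N.toSubmodule (fun x w hw => N.lie_mem hw) (by
      have e : (⟨φ (Induced.generator D.nPos lam), (φ.mem_range _).2 ⟨_, rfl⟩⟩ : φ.range) =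
          c • w :=
        Subtype.ext (congrArg (fun w : D.whittakerSpace V lam => (w : V)) hc).symm
      rw [e]
      exact N.smul_mem c hwN)
    exact (LieSubmodule.toSubmodule_eq_top N).1 htop

lemma whittakerVectors_range (hn : ∀ y : g, ∃ d, y ∈ depthFiltration D.nPos d)
    (φ : D.StandardWhittaker lam →ₗ⁅ℂ, g⁆ V) :
    D.whittakerVectors φ.range = D.whittakerSpace φ.range lam := by
  ext w
  constructor
  · intro hw x
    obtain ⟨c, hc⟩ := Submodule.mem_span_singleton.1 (hw x)
    obtain ⟨m, hm⟩ := (φ.mem_range _).1 w.2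
    obtain ⟨k, hk⟩ := exists_mem_whittakerFiltration lam hn φ m
    rw [hm] at hk
    have h1 := pow_smul_eq_zero_of_lie_eq_smul lam hk (x := x) (c := c)
      (congrArg Subtype.val hc).symm
    rcases smul_eq_zero.1 h1 with h | h
    · rw [← hc, sub_eq_zero.1 (eq_zero_of_pow_eq_zero h)]
    · have hw0 : w = 0 := Subtype.ext h
      rw [hw0, lie_zero, smul_zero]
  · intro hw x
    rw [hw x]
    exact Submodule.smul_mem _ _ (Submodule.mem_span_singleton_self w)

end Simplicity

/-! ## The Whittaker functionals on a Verma module -/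

section Verma

variable {g : Type u} [LieRing g] [LieAlgebra ℂ g] (D : TriangularDecomposition g)

lemma isCompl_nPos_borelNeg : IsCompl D.nPos.toSubmodule D.borelNeg.toSubmodule := by
  obtain ⟨hind, htop⟩ := (DirectSum.isInternal_submodule_iff_iSupIndep_and_iSup_eq_top _).1
    D.isInternal
  have e1 : D.borelNeg.toSubmodule = D.cartan.toSubmodule ⊔ D.nNeg.toSubmodule := rfl
  constructor
  · refine (hind 2).mono_right ?_
    rw [e1]
    refine sup_le ?_ ?_
    · exact le_iSup₂_of_le (1 : Fin 3) (by decide) le_rfl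
    · exact le_iSup₂_of_le (0 : Fin 3) (by decide) le_rfl
  · rw [codisjoint_iff, eq_top_iff, ← htop, e1]
    refine iSup_le fun j => ?_
    fin_cases j
    · exact le_sup_of_le_right le_sup_right
    · exact le_sup_of_le_right le_sup_left
    · exact le_sup_left

lemma finrank_whittakerSpace_dual (lam : LieCharacter ℂ D.nPos) (μ : Dual ℂ D.cartan) :
    finrank ℂ (D.whittakerSpace (Dual ℂ (D.LowestVerma μ)) lam) = 1 := by
  -- The dual action carries a sign, so type `lam` in the dual means that the functional transforms
  -- by `-lam`. This is again a character, because characters vanish on brackets.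
  let lam' : LieCharacter ℂ D.nPos :=
    { toLinearMap := -(lam : D.nPos →ₗ[ℂ] ℂ)
      map_lie' := fun {x y} => by
        change -lam ⁅x, y⁆ = (-lam x) * (-lam y) - (-lam y) * (-lam x)
        rw [lieCharacter_apply_lie]
        ring }
  have hlam' : ∀ x, lam' x = -lam x := fun x => rfl
  obtain ⟨f, hf1, hf⟩ := exists_whittaker_functional D.nPos D.borelNeg D.isCompl_nPos_borelNeg
    (D.borelNegCharacter μ) lam'
  have hfW : f ∈ D.whittakerSpace (Dual ℂ (D.LowestVerma μ)) lam := by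
    intro x
    ext m
    rw [Module.Dual.lie_apply, hf, hlam', neg_smul, neg_neg, LinearMap.smul_apply]
  refine finrank_eq_one ⟨f, hfW⟩ (fun h => ?_) ?_
  · have h0 : f = 0 := congrArg Subtype.val h
    rw [h0] at hf1
    exact zero_ne_one hf1
  · rintro ⟨f', hf'⟩
    refine ⟨f' (Induced.generator _ _), Subtype.ext ?_⟩
    change f' (Induced.generator _ _) • f = f'
    -- The kernel of such a functional is `n₊`-stable; if it contains the generator, it is
    -- everything.
    have key : ∀ h ∈ D.whittakerSpace (Dual ℂ (D.LowestVerma μ)) lam,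
        h (Induced.generator _ _) = 0 → h = 0 := by
      intro h hh h0
      have htop := submodule_eq_top_of_isCompl D.nPos D.borelNeg D.isCompl_nPos_borelNeg
        (D.borelNegCharacter μ) (LinearMap.ker h) h0 fun x m hm => by
          have h1 := DFunLike.congr_fun (hh x) m
          rw [Module.Dual.lie_apply, LinearMap.smul_apply, LinearMap.mem_ker.1 hm, smul_zero,
            neg_eq_zero] at h1
          exact h1
      exact LinearMap.ker_eq_top.1 htop
    rw [← sub_eq_zero]
    refine key _ (sub_mem (Submodule.smul_mem _ _ hfW) hf') ?_
    rw [LinearMap.sub_apply, LinearMap.smul_apply, hf1, smul_eq_mul, mul_one, sub_self]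

end Verma

/-! ## The height and the depth filtration -/

section Height

variable {g : Type u} [LieRing g] [LieAlgebra ℂ g] (D : TriangularDecomposition g)

/-- The operators `ad t`, `t ∈ h`, commute, and weight spaces lie in their simultaneous generalized
eigenspaces, which are independent. -/
lemma iSupIndep_adWeightSpace : iSupIndep (adWeightSpace D.cartan) := by
  let f : D.cartan → Module.End ℂ g := fun t => LieAlgebra.ad ℂ g (t : g)
  have hcomm : ∀ s t : D.cartan, Commute (f s) (f t) := fun s t => by
    ext x
    change ⁅(s : g), ⁅(t : g), x⁆⁆ = ⁅(t : g), ⁅(s : g), x⁆⁆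
    rw [leibniz_lie, D.cartan_abelian _ s.2 _ t.2, zero_lie, zero_add]
  have h1 := Module.End.independent_iInf_maxGenEigenspace_of_forall_mapsTo f
    (fun s t c => Module.End.mapsTo_maxGenEigenspace_of_comm (hcomm t s) c)
  have h2 := h1.comp (f := fun α : Dual ℂ D.cartan => (α : D.cartan → ℂ)) DFunLike.coe_injective
  refine h2.mono fun α x hx => ?_
  rw [Function.comp_apply, Submodule.mem_iInf]
  intro t
  refine Module.End.mem_maxGenEigenspace _ _ _ |>.2 ⟨1, ?_⟩
  have h3 : f t x = α t • x := hx t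
  rw [pow_one, LinearMap.sub_apply, h3, LinearMap.smul_apply, Module.End.one_apply, sub_self]

lemma exists_height : ∃ ht : Dual ℂ (Dual ℂ D.cartan),
    ∀ α ∈ AddSubmonoid.closure D.simpleRoots, α ≠ 0 → ∃ k : ℕ, 0 < k ∧ ht α = k := by
  -- Linear independence of `Π` allows a linear form equal to `1` on all of `Π`; its values on the
  -- other basis vectors do not matter.
  let b := Basis.extend D.linearIndependent
  let ht : Dual ℂ (Dual ℂ D.cartan) := b.constr ℂ fun _ => (1 : ℂ)
  have hht : ∀ α ∈ D.simpleRoots, ht α = 1 := fun α hα => by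
    have hα' := D.linearIndependent.subset_extend (Set.subset_univ _) hα
    have e : b ⟨α, hα'⟩ = α := Basis.extend_apply_self _ _
    conv_lhs => rw [← e]
    exact b.constr_basis ℂ _ _
  refine ⟨ht, fun α hα h0 => ?_⟩
  have key : α = 0 ∨ ∃ k : ℕ, 0 < k ∧ ht α = k := by
    clear h0
    induction hα using AddSubmonoid.closure_induction with
    | mem α hα => exact Or.inr ⟨1, one_pos, by rw [hht α hα, Nat.cast_one]⟩
    | zero => exact Or.inl rfl
    | add α β _ _ h1 h2 =>
      rcases h1 with rfl | ⟨k, hk, hk'⟩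
      · rwa [zero_add]
      · rcases h2 with rfl | ⟨l, hl, hl'⟩
        · rw [add_zero]
          exact Or.inr ⟨k, hk, hk'⟩
        · exact Or.inr ⟨k + l, Nat.add_pos_left hk l, by rw [map_add, hk', hl', Nat.cast_add]⟩
  exact key.resolve_left h0

/-- The anti-involution fixes `h` and reverses brackets, so it carries weight `α` to weight `-α`. -/
lemma nNeg_le_iSup : D.nNeg.toSubmodule ≤
    ⨆ α ∈ {α : Dual ℂ D.cartan | α ∈ AddSubmonoid.closure D.simpleRoots ∧ α ≠ 0},
      D.nNeg.toSubmodule ⊓ adWeightSpace D.cartan (-α) := by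
  conv_lhs => rw [← D.sigma_nPos, D.weight_decomposition]
  rw [Submodule.map_iSup]
  refine iSup_mono fun α => ?_
  rw [Submodule.map_iSup]
  refine iSup_mono fun _ => ?_
  rintro _ ⟨x, ⟨hx, hxα⟩, rfl⟩
  refine ⟨D.sigma_nPos ▸ Submodule.mem_map_of_mem hx, fun t => ?_⟩
  have h1 : ⁅(t : g), x⁆ = α t • x := hxα t
  have h2 : ⁅(t : g), D.sigma x⁆ = D.sigma ⁅x, (t : g)⁆ := by
    rw [D.sigma_lie, D.sigma_cartan t t.2]
  rw [h2, ← lie_skew, h1, map_neg, map_smul, LinearMap.neg_apply, neg_smul]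

lemma height_of_mem_nNeg {ht : Dual ℂ (Dual ℂ D.cartan)}
    (hht : ∀ α ∈ AddSubmonoid.closure D.simpleRoots, α ≠ 0 → ∃ k : ℕ, 0 < k ∧ ht α = k)
    {y : g} (hy : y ∈ D.nNeg) {γ : Dual ℂ D.cartan} (hγ : y ∈ adWeightSpace D.cartan γ)
    (hy0 : y ≠ 0) : ∃ k : ℕ, 0 < k ∧ ht γ = -k := by
  by_contra hne
  -- Otherwise `γ` differs from every weight `-α` occurring in `n₋`, and `y` lies in the sum of the
  -- other weight spaces, against independence.
  have h1 : y ∈ ⨆ δ, ⨆ (_ : δ ≠ γ), adWeightSpace D.cartan δ := by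
    have h2 : D.nNeg.toSubmodule ≤ ⨆ δ, ⨆ (_ : δ ≠ γ), adWeightSpace D.cartan δ := by
      refine D.nNeg_le_iSup.trans (iSup₂_le fun α hα => ?_)
      obtain ⟨k, hk, hk'⟩ := hht α hα.1 hα.2
      have hαγ : -α ≠ γ := by
        rintro rfl
        exact hne ⟨k, hk, by rw [map_neg, hk']⟩
      exact inf_le_right.trans (le_iSup₂_of_le (-α) hαγ le_rfl)
    exact h2 hy
  exact hy0 (Submodule.disjoint_def.1 (D.iSupIndep_adWeightSpace γ) y hγ h1)

lemma disjoint_nNeg : Disjoint D.nNeg.toSubmodule (D.cartan.toSubmodule ⊔ D.nPos.toSubmodule) := by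
  have hind := ((DirectSum.isInternal_submodule_iff_iSupIndep_and_iSup_eq_top _).1
    D.isInternal).1
  refine (hind 0).mono_right (sup_le ?_ ?_)
  · exact le_iSup₂_of_le (1 : Fin 3) (by decide) le_rfl
  · exact le_iSup₂_of_le (2 : Fin 3) (by decide) le_rfl

lemma exists_eq_add (y : g) :
    ∃ a ∈ D.nNeg, ∃ r ∈ D.cartan.toSubmodule ⊔ D.nPos.toSubmodule, y = a + r := by
  have hy : y ∈ D.nPos.toSubmodule ⊔ D.borelNeg.toSubmodule :=
    D.isCompl_nPos_borelNeg.sup_eq_top ▸ Submodule.mem_top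
  obtain ⟨x, hx, b, hb, rfl⟩ := Submodule.mem_sup.1 hy
  obtain ⟨t, ht, a, ha, rfl⟩ := Submodule.mem_sup.1 hb
  exact ⟨a, ha, t + x, Submodule.add_mem_sup ht hx, by abel⟩

/-- The component in `n₋` of a weight vector is a weight vector. -/
lemma mem_adWeightSpace_nNeg_component {a r : g} (ha : a ∈ D.nNeg)
    (hr : r ∈ D.cartan.toSubmodule ⊔ D.nPos.toSubmodule) {γ : Dual ℂ D.cartan}
    (h : a + r ∈ adWeightSpace D.cartan γ) : a ∈ adWeightSpace D.cartan γ := by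
  intro t
  have h1 : ⁅(t : g), a + r⁆ = γ t • (a + r) := h t
  have h2 : ⁅(t : g), r⁆ ∈ D.cartan.toSubmodule ⊔ D.nPos.toSubmodule := by
    obtain ⟨s, hs, x, hx, rfl⟩ := Submodule.mem_sup.1 hr
    rw [lie_add, D.cartan_abelian _ t.2 _ hs, zero_add]
    exact (le_sup_right : D.nPos.toSubmodule ≤ _) (D.lie_cartan_nPos t.2 hx)
  have e : ⁅(t : g), a⁆ - γ t • a = γ t • r - ⁅(t : g), r⁆ := by
    rw [lie_add, smul_add] at h1
    rw [sub_eq_sub_iff_add_eq_add, h1]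
    abel
  rw [← sub_eq_zero]
  refine Submodule.disjoint_def.1 D.disjoint_nNeg _ ?_ ?_
  · exact sub_mem (D.lie_cartan_nNeg t.2 ha) (Submodule.smul_mem _ _ ha)
  · rw [e]
    exact sub_mem (Submodule.smul_mem _ _ hr) h2

lemma cartan_sup_nPos_le_depthFiltration :
    D.cartan.toSubmodule ⊔ D.nPos.toSubmodule ≤ depthFiltration D.nPos 1 := by
  refine sup_le ?_ (depthFiltration_mono D.nPos zero_le_one)
  intro t ht
  rw [mem_depthFiltration_succ]
  intro x
  rw [← lie_skew]
  exact neg_mem (D.lie_cartan_nPos ht x.2)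

lemma lie_mem_adWeightSpace {α β : Dual ℂ D.cartan} {x y : g}
    (hx : x ∈ adWeightSpace D.cartan α) (hy : y ∈ adWeightSpace D.cartan β) :
    ⁅x, y⁆ ∈ adWeightSpace D.cartan (α + β) := by
  intro t
  have h1 : ⁅(t : g), x⁆ = α t • x := hx t
  have h2 : ⁅(t : g), y⁆ = β t • y := hy t
  rw [leibniz_lie, h1, h2, smul_lie, lie_smul, LinearMap.add_apply, add_smul]

/-- A bracket with a vector of `n₊` of height `n > 0` raises the height from `-m` to `n - m`. Its
component in `n₋` is zero or has height `-k` with `k < m`, to which induction applies; the rest lies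
in `h ⊕ n₊`, of depth at most `1`. The extra `1` in `m + 1` accounts for `h`. -/
lemma mem_depthFiltration_of_height {ht : Dual ℂ (Dual ℂ D.cartan)}
    (hht : ∀ α ∈ AddSubmonoid.closure D.simpleRoots, α ≠ 0 → ∃ k : ℕ, 0 < k ∧ ht α = k)
    (m : ℕ) (hm : 0 < m) {γ : Dual ℂ D.cartan} (hγ : ht γ = -m) {y : g}
    (hyγ : y ∈ adWeightSpace D.cartan γ) :
    y ∈ D.nNeg → y ∈ depthFiltration D.nPos (m + 1) := by
  induction m using Nat.strong_induction_on generalizing γ y with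
  | _ m ih =>
    intro hy
    rw [mem_depthFiltration_succ]
    let S : Submodule ℂ g := (depthFiltration D.nPos m).comap (LieAlgebra.ad ℂ g y : g →ₗ[ℂ] g)
    have hS : D.nPos.toSubmodule ≤ S := by
      conv_lhs => rw [D.weight_decomposition]
      refine iSup₂_le fun α hα => ?_
      rintro x ⟨hx, hxα⟩
      change ⁅y, x⁆ ∈ depthFiltration D.nPos m
      obtain ⟨n, hn, hn'⟩ := hht α hα.1 hα.2
      have hw : ⁅y, x⁆ ∈ adWeightSpace D.cartan (γ + α) := D.lie_mem_adWeightSpace hyγ hxα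
      obtain ⟨a, ha, r, hr, e⟩ := D.exists_eq_add ⁅y, x⁆
      rw [e] at hw ⊢
      refine add_mem ?_ (depthFiltration_mono D.nPos hm (D.cartan_sup_nPos_le_depthFiltration hr))
      have haw := D.mem_adWeightSpace_nNeg_component ha hr hw
      by_cases ha0 : a = 0
      · rw [ha0]
        exact zero_mem _
      · obtain ⟨k, hk, hk'⟩ := D.height_of_mem_nNeg hht ha haw ha0
        have hkm : k + n = m := by
          rw [map_add, hγ, hn'] at hk'
          have h1 : ((k + n : ℕ) : ℂ) = (m : ℕ) := by
            push_cast
            linear_combination hk'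
          exact_mod_cast h1
        exact depthFiltration_mono D.nPos (by omega) (ih k (by omega) hk hk' haw ha)
    intro x
    rw [← lie_skew]
    exact neg_mem (hS x.2)

lemma exists_mem_depthFiltration (y : g) : ∃ d, y ∈ depthFiltration D.nPos d := by
  have hdir : Directed (· ≤ ·) (depthFiltration D.nPos) :=
    (depthFiltration_mono D.nPos).directed_le
  rw [← Submodule.mem_iSup_of_directed _ hdir]
  obtain ⟨ht, hht⟩ := D.exists_height
  obtain ⟨a, ha, r, hr, rfl⟩ := D.exists_eq_add y
  refine add_mem ?_ (Submodule.mem_iSup_of_mem 1 (D.cartan_sup_nPos_le_depthFiltration hr))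
  have hle : D.nNeg.toSubmodule ≤ ⨆ d, depthFiltration D.nPos d := by
    refine D.nNeg_le_iSup.trans (iSup₂_le fun α hα => ?_)
    rintro z ⟨hz, hzα⟩
    obtain ⟨k, hk, hk'⟩ := hht α hα.1 hα.2
    exact Submodule.mem_iSup_of_mem (k + 1)
      (D.mem_depthFiltration_of_height hht k hk (by rw [map_neg, hk']) hzα hz)
  exact hle ha

end Height

/-! ## Local finiteness -/

section LocallyFinite

variable {g : Type u} [LieRing g] [LieAlgebra ℂ g] (D : TriangularDecomposition g)
variable {V : Type v} [AddCommGroup V] [Module ℂ V] [LieRingModule g V] [LieModule ℂ g V]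
variable {lam : LieCharacter ℂ D.nPos}

/-- If every element of `g` lies in a finite-dimensional subspace that is stable under `n₊`
modulo `n₊`, then the images of the standard Whittaker modules are Whittaker modules. -/
lemma isWhittakerModule_range
    (hg : ∀ y : g, ∃ F : Submodule ℂ g, FiniteDimensional ℂ F ∧ y ∈ F ∧
      ∀ x : D.nPos, ∀ z ∈ F, ⁅(x : g), z⁆ ∈ F ⊔ D.nPos.toSubmodule)
    (φ : D.StandardWhittaker lam →ₗ⁅ℂ, g⁆ V) : D.IsWhittakerModule φ.range := by
  let S : Submodule ℂ φ.range :=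
    { carrier := {w | ∃ E : Submodule ℂ φ.range, FiniteDimensional ℂ E ∧ w ∈ E ∧
        ∀ x : D.nPos, ∀ v ∈ E, ⁅(x : g), v⁆ ∈ E}
      add_mem' := by
        rintro a b ⟨E, h1, h2, h3⟩ ⟨E', h1', h2', h3'⟩
        refine ⟨E ⊔ E', inferInstance, Submodule.add_mem_sup h2 h2', fun x v hv => ?_⟩
        obtain ⟨s, hs, t, ht, rfl⟩ := Submodule.mem_sup.1 hv
        rw [lie_add]
        exact Submodule.add_mem_sup (h3 x s hs) (h3' x t ht)
      zero_mem' := ⟨⊥, inferInstance, zero_mem _, fun x v hv => by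
        rw [(Submodule.mem_bot ℂ).1 hv, lie_zero]
        exact zero_mem _⟩
      smul_mem' := by
        rintro c a ⟨E, h1, h2, h3⟩
        exact ⟨E, h1, E.smul_mem c h2, h3⟩ }
  have hS : S = ⊤ := by
    refine D.lieSubmodule_range_eq_top φ S ?_ ?_
    · rintro y w ⟨E, h1, h2, h3⟩
      obtain ⟨F, hF1, hF2, hF3⟩ := hg y
      let B : g →ₗ[ℂ] φ.range →ₗ[ℂ] φ.range := (LieModule.toEnd ℂ g φ.range : g →ₗ[ℂ] _)
      have hB : ∀ z ∈ F, ∀ v ∈ E, ⁅z, v⁆ ∈ Submodule.map₂ B F E := fun z hz v hv =>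
        Submodule.apply_mem_map₂ B hz hv
      -- The enlarged space `E + F·E` is `n₊`-stable: in `x(zv) = [x, z]v + z(xv)` the bracket lies
      -- in `F + n₊`, and `n₊` preserves `E`.
      refine ⟨E ⊔ Submodule.map₂ B F E, ?_, Submodule.mem_sup_right (hB y hF2 w h2), ?_⟩
      · have : FiniteDimensional ℂ (Submodule.map₂ B F E) := Module.Finite.iff_fg.2
          (Submodule.FG.map₂ B (Module.Finite.iff_fg.1 hF1) (Module.Finite.iff_fg.1 h1))
        infer_instance
      · intro x v hv
        have hle : E ⊔ Submodule.map₂ B F E ≤ (E ⊔ Submodule.map₂ B F E).comap (B x) := by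
          refine sup_le (fun v hv => Submodule.mem_sup_left (h3 x v hv)) ?_
          rw [Submodule.map₂_le]
          intro z hz v hv
          change ⁅(x : g), ⁅z, v⁆⁆ ∈ E ⊔ Submodule.map₂ B F E
          rw [leibniz_lie]
          refine add_mem ?_ (Submodule.mem_sup_right (hB z hz _ (h3 x v hv)))
          obtain ⟨z', hz', x', hx', e⟩ := Submodule.mem_sup.1 (hF3 x z hz)
          rw [← e, add_lie]
          exact add_mem (Submodule.mem_sup_right (hB z' hz' v hv))
            (Submodule.mem_sup_left (h3 ⟨x', hx'⟩ v hv))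
        exact hle hv
    · refine ⟨Submodule.span ℂ {_}, inferInstance, Submodule.mem_span_singleton_self _, ?_⟩
      intro x v hv
      obtain ⟨c, rfl⟩ := Submodule.mem_span_singleton.1 hv
      rw [lie_smul]
      refine Submodule.smul_mem _ _ (Submodule.mem_span_singleton.2 ⟨lam x, ?_⟩)
      exact Subtype.ext (D.generator_mem_whittakerSpace φ x).symm
  intro w
  obtain ⟨E, h1, h2, h3⟩ : w ∈ S := hS ▸ Submodule.mem_top
  have hle : (LieSubmodule.lieSpan ℂ D.nPos ({w} : Set φ.range)).toSubmodule ≤ E :=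
    LieSubmodule.lieSpan_le (N := { E with lie_mem := fun {x v} hv => h3 x v hv }) |>.2
      (Set.singleton_subset_iff.2 h2)
  exact Submodule.finiteDimensional_of_le hle

end LocallyFinite

variable {g : Type u} [LieRing g] [LieAlgebra ℂ g] (D : TriangularDecomposition g)

lemma exists_hom_dual_ne_zero (lam : LieCharacter ℂ D.nPos) (μ : Dual ℂ D.cartan) :
    ∃ φ : D.StandardWhittaker lam →ₗ⁅ℂ, g⁆ Dual ℂ (D.LowestVerma μ), φ ≠ 0 := by
  obtain ⟨w, hw0, -⟩ := finrank_eq_one_iff'.1 (D.finrank_whittakerSpace_dual lam μ)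
  obtain ⟨φ, hφ, -⟩ := D.existsUnique_hom w.2
  refine ⟨φ, ?_⟩
  rintro rfl
  exact hw0 (Subtype.ext hφ.symm)

end TriangularDecomposition

namespace Virasoro

/-! ## The Virasoro algebra: characters and local finiteness -/

lemma wittBracket_apply_eq_zero {x y : ℤ →₀ ℂ}
    (hx : x ∈ Finsupp.supported ℂ ℂ {i : ℤ | 0 < i})
    (hy : y ∈ Finsupp.supported ℂ ℂ {i : ℤ | 0 < i}) {k : ℤ} (hk : k ≤ 2) :
    wittBracket x y k = 0 := by
  rw [Finsupp.supported_eq_span_single] at hx hy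
  induction hx using Submodule.span_induction with
  | zero => simp
  | add a b _ _ ha hb => simp [ha, hb]
  | smul c a _ ha => simp [ha]
  | mem a ha =>
    obtain ⟨i, hi, rfl⟩ := ha
    induction hy using Submodule.span_induction with
    | zero => simp
    | add a b _ _ ha hb => rw [map_add, Finsupp.add_apply, ha, hb, add_zero]
    | smul c a _ ha => rw [map_smul, Finsupp.smul_apply, ha, smul_zero]
    | mem b hb =>
      obtain ⟨j, hj, rfl⟩ := hb
      change wittBracket (Finsupp.single i 1) (Finsupp.single j 1) k = 0
      rw [wittBracket_single, Finsupp.single_apply]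
      split_ifs with h
      · have h1 : (0 : ℤ) < i := hi
        have h2 : (0 : ℤ) < j := hj
        -- Two positive indices with sum at most `2` are both `1`, and then the structure constant
        -- `j - i` is zero.
        obtain rfl : i = 1 := by omega
        obtain rfl : j = 1 := by omega
        simp
      · rfl

/-- The character of `n₊` with given values at `e 1` and `e 2`. -/
def nPosCharacter (a b : ℂ) : LieCharacter ℂ nPos where
  toLinearMap := (a • Finsupp.lapply 1 + b • Finsupp.lapply 2 : (ℤ →₀ ℂ) →ₗ[ℂ] ℂ) ∘ₗ coeffₗ ∘ₗ
    nPos.toSubmodule.subtype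
  map_lie' := by
    intro x y
    change a * wittBracket _ _ 1 + b * wittBracket _ _ 2 = _ * _ - _ * _
    have h : ∀ k ≤ 2, wittBracket (x : Virasoro).coeff (y : Virasoro).coeff k = 0 := fun k hk =>
      wittBracket_apply_eq_zero x.2.1 y.2.1 hk
    rw [h 1 (by norm_num), h 2 le_rfl, mul_zero, mul_zero, add_zero, mul_comm,
      sub_self]

lemma nPosCharacter_apply (a b : ℂ) (x : nPos) :
    nPosCharacter a b x = a * (x : Virasoro).coeff 1 + b * (x : Virasoro).coeff 2 := rfl

/-- Here `[e 1, e (i - 1)] = (i - 2) e i` with `i - 2 ≠ 0`, and characters vanish on brackets. -/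
lemma character_e_eq_zero (lam : LieCharacter ℂ nPos) {i : ℤ} (hi : 2 < i) (hi' : 0 < i) :
    lam ⟨e i, e_mem_nPos hi'⟩ = 0 := by
  have h1 := lieCharacter_apply_lie lam ⟨e 1, e_mem_nPos one_pos⟩
    ⟨e (i - 1), e_mem_nPos (by omega)⟩
  have h2 : (⁅(⟨e 1, e_mem_nPos one_pos⟩ : nPos), ⟨e (i - 1), e_mem_nPos (by omega)⟩⁆ : nPos) =
      ((i : ℂ) - 2) • ⟨e i, e_mem_nPos hi'⟩ := by
    apply Subtype.ext
    change ⁅e 1, e (i - 1)⁆ = ((i : ℂ) - 2) • e i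
    rw [e_lie_e, if_neg (by omega), zero_smul, add_zero, add_sub_cancel]
    congr 1
    push_cast
    ring
  rw [h2, map_smul] at h1
  refine (smul_eq_zero.1 h1).resolve_left fun h => ?_
  have h3 : (i : ℂ) = (2 : ℤ) := by
    push_cast
    exact sub_eq_zero.1 h
  have h4 : i = 2 := by exact_mod_cast h3
  omega

lemma character_ext {lam lam' : LieCharacter ℂ nPos}
    (h1 : lam ⟨e 1, e_mem_nPos (by norm_num)⟩ = lam' ⟨e 1, e_mem_nPos (by norm_num)⟩)
    (h2 : lam ⟨e 2, e_mem_nPos (by norm_num)⟩ = lam' ⟨e 2, e_mem_nPos (by norm_num)⟩) :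
    lam = lam' := by
  let S : Submodule ℂ Virasoro := (LinearMap.eqLocus (lam : nPos →ₗ[ℂ] ℂ)
    (lam' : nPos →ₗ[ℂ] ℂ)).map nPos.toSubmodule.subtype
  have hS : ∀ i : ℤ, 0 < i → e i ∈ S := fun i hi => by
    refine ⟨⟨e i, e_mem_nPos hi⟩, ?_, rfl⟩
    change lam ⟨e i, e_mem_nPos hi⟩ = lam' ⟨e i, e_mem_nPos hi⟩
    rcases lt_or_ge 2 i with h | h
    · rw [character_e_eq_zero lam h hi, character_e_eq_zero lam' h hi]
    · obtain rfl | rfl : i = 1 ∨ i = 2 := by omega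
      · exact h1
      · exact h2
  ext x
  have hx : (x : Virasoro) ∈ S := by
    rw [eq_sum x.2]
    exact Submodule.sum_mem _ fun i hi => S.smul_mem _ (hS i (x.2.1 hi))
  obtain ⟨y, hy, hyx⟩ := hx
  obtain rfl : y = x := Subtype.ext hyx
  exact hy

lemma existsUnique_character (a b : ℂ) : ∃! lam : LieCharacter ℂ nPos,
    lam ⟨e 1, e_mem_nPos (by norm_num)⟩ = a ∧ lam ⟨e 2, e_mem_nPos (by norm_num)⟩ = b := by
  have h1 : nPosCharacter a b ⟨e 1, e_mem_nPos (by norm_num)⟩ = a := by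
    simp [nPosCharacter_apply, e]
  have h2 : nPosCharacter a b ⟨e 2, e_mem_nPos (by norm_num)⟩ = b := by
    simp [nPosCharacter_apply, e]
  exact ⟨nPosCharacter a b, ⟨h1, h2⟩, fun lam h =>
    character_ext (h.1.trans h1.symm) (h.2.trans h2.symm)⟩

lemma finiteDimensional_comap_supported {s : Set ℤ} (hs : s.Finite) :
    FiniteDimensional ℂ ((Finsupp.supported ℂ ℂ s).comap coeffₗ) := by
  have h1 : FiniteDimensional ℂ (Finsupp.supported ℂ ℂ s) := by
    rw [Finsupp.supported_eq_span_single]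
    exact FiniteDimensional.span_of_finite ℂ (hs.image _)
  let F := (Finsupp.supported ℂ ℂ s).comap coeffₗ
  let f : F →ₗ[ℂ] Finsupp.supported ℂ ℂ s × ℂ :=
    LinearMap.prod ((coeffₗ ∘ₗ F.subtype).codRestrict _ fun x => x.2) (centralₗ ∘ₗ F.subtype)
  refine FiniteDimensional.of_injective f fun x y hxy => Subtype.ext (Virasoro.ext ?_ ?_)
  · exact congrArg Subtype.val (congrArg Prod.fst hxy)
  · exact congrArg Prod.snd hxy

/-- Take the span of `z` and the `e i` with `|i| ≤ m`. Brackets with `n₊` only raise indices, so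
they never fall below `-m`, and whatever exceeds `m ≥ 0` lies in `n₊`. -/
lemma exists_finiteDimensional_stable (y : Virasoro) :
    ∃ F : Submodule ℂ Virasoro, FiniteDimensional ℂ F ∧ y ∈ F ∧
      ∀ x : nPos, ∀ v ∈ F, ⁅(x : Virasoro), v⁆ ∈ F ⊔ nPos.toSubmodule := by
  obtain ⟨m, hm0, hm⟩ : ∃ m : ℤ, 0 ≤ m ∧ ∀ i ∈ y.coeff.support, |i| ≤ m :=
    ⟨∑ i ∈ y.coeff.support, |i|, Finset.sum_nonneg fun _ _ => abs_nonneg _, fun i hi =>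
      Finset.single_le_sum (f := fun i : ℤ => |i|) (fun _ _ => abs_nonneg _) hi⟩
  refine ⟨(Finsupp.supported ℂ ℂ (Set.Icc (-m) m)).comap coeffₗ,
    finiteDimensional_comap_supported (Set.finite_Icc _ _), fun i hi => abs_le.1 (hm i hi), ?_⟩
  intro x v hv
  have h1 : ⁅(x : Virasoro), v⁆.coeff ∈ Finsupp.supported ℂ ℂ (Set.Ici (-m)) :=
    wittBracket_mem (fun i (hi : 0 < i) j hj => by
      rw [Set.mem_Ici]
      rw [Set.mem_Icc] at hj
      omega) x.2.1 hv
  generalize ⁅(x : Virasoro), v⁆ = w at h1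
  -- Truncate at index `m`. The central coefficient stays with the finite-dimensional part, since
  -- elements of `n₊` have none.
  have e1 : w = ⟨w.coeff.filter (· ≤ m), w.central⟩ + ⟨w.coeff.filter (fun i => ¬ i ≤ m), 0⟩ := by
    ext1
    · exact (Finsupp.filter_add_filter_not _ _).symm
    · simp
  rw [e1]
  refine Submodule.add_mem_sup ?_ ((mem_nPos_iff _).2 ⟨fun i hi => ?_, rfl⟩)
  · change w.coeff.filter (· ≤ m) ∈ Finsupp.supported ℂ ℂ (Set.Icc (-m) m)
    rw [Finsupp.mem_supported'] at h1 ⊢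
    intro i hi
    rw [Finsupp.filter_apply]
    split_ifs with h
    · exact h1 i fun h' => hi ⟨h', h⟩
    · rfl
  · exact Finsupp.filter_apply_neg _ _ (not_not.2 (hi.trans hm0))

end Virasoro

end WhittakerPairs

end

theorem corollary43 :
    (∀ (g : Type u) [LieRing g] [LieAlgebra ℂ g] (D : TriangularDecomposition g)
        (lam : LieAlgebra.LieCharacter ℂ D.nPos) (mu : Module.Dual ℂ D.cartan),
      -- the homomorphism `M_lam → N(-mu)*` that defines `L(lam, mu)` exists and is unique up to
      -- a nonzero scalar
      Module.finrank ℂ (D.whittakerSpace (Module.Dual ℂ (D.LowestVerma (-mu))) lam) = 1 ∧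
      (∀ w ∈ D.whittakerSpace (Module.Dual ℂ (D.LowestVerma (-mu))) lam,
        ∃! φ : D.StandardWhittaker lam →ₗ⁅ℂ, g⁆ Module.Dual ℂ (D.LowestVerma (-mu)),
          φ (Induced.generator D.nPos lam) = w) ∧
      -- its image `L(lam, mu)` is simple and has a one-dimensional space of Whittaker vectors
      ∀ φ : D.StandardWhittaker lam →ₗ⁅ℂ, g⁆ Module.Dual ℂ (D.LowestVerma (-mu)), φ ≠ 0 →
        LieModule.IsIrreducible ℂ g φ.range ∧
        Module.finrank ℂ (D.whittakerSpace φ.range lam) = 1 ∧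
        D.whittakerVectors φ.range = D.whittakerSpace φ.range lam) ∧
    -- the Virasoro algebra: the characters of `n₊` are given by arbitrary values at `e 1`, `e 2`
    (∀ a b : ℂ, ∃! lam : LieAlgebra.LieCharacter ℂ Virasoro.triangularDecomposition.nPos,
      lam ⟨Virasoro.e 1, Virasoro.e_mem_nPos (by norm_num)⟩ = a ∧
      lam ⟨Virasoro.e 2, Virasoro.e_mem_nPos (by norm_num)⟩ = b) ∧
    (∀ (lam : LieAlgebra.LieCharacter ℂ Virasoro.triangularDecomposition.nPos)
        (mu : Module.Dual ℂ Virasoro.triangularDecomposition.cartan),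
      ∃ φ : Virasoro.triangularDecomposition.StandardWhittaker lam →ₗ⁅ℂ, Virasoro⁆
          Module.Dual ℂ (Virasoro.triangularDecomposition.LowestVerma (-mu)),
        φ ≠ 0 ∧
        LieModule.IsIrreducible ℂ Virasoro φ.range ∧
        Virasoro.triangularDecomposition.IsWhittakerModule φ.range ∧
        Module.finrank ℂ (Virasoro.triangularDecomposition.whittakerSpace φ.range lam) = 1) := by
  refine ⟨fun g _ _ D lam mu => ⟨D.finrank_whittakerSpace_dual lam (-mu),
    fun w hw => D.existsUnique_hom hw, fun φ hφ =>
      ⟨D.isIrreducible_range D.exists_mem_depthFiltration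
        (D.finrank_whittakerSpace_dual lam (-mu)) hφ,
      D.finrank_whittakerSpace_range (D.finrank_whittakerSpace_dual lam (-mu)) hφ,
      D.whittakerVectors_range D.exists_mem_depthFiltration φ⟩⟩,
    Virasoro.existsUnique_character, fun lam mu => ?_⟩
  obtain ⟨φ, hφ⟩ := Virasoro.triangularDecomposition.exists_hom_dual_ne_zero lam (-mu)
  have h1 := Virasoro.triangularDecomposition.finrank_whittakerSpace_dual lam (-mu)
  exact ⟨φ, hφ, TriangularDecomposition.isIrreducible_range _
    (TriangularDecomposition.exists_mem_depthFiltration _) h1 hφ,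
    TriangularDecomposition.isWhittakerModule_range _
      Virasoro.exists_finiteDimensional_stable φ,
    TriangularDecomposition.finrank_whittakerSpace_range _ h1 hφ⟩
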